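/- **Setting.** Let $\lambda_1,\lambda_2,\theta_1,\theta_2,\mu_{1,1},\mu_{1,2},\mu_{2,2},m_1,m_2>0$, $\kappa\ge 0$, and let $r=j/k$ with $j,k$ positive integers without common factor. Let $x=(q_1,q_2,z_{1,2})\in[\kappa,\infty)\times[0,\infty)\times[0,m_2]$ with $q_1-rq_2=\kappa$. The fast-time-scale process $D=\{D(s):s\ge0\}$ at $x$ is the continuous-time Markov chain on $\mathbb Z$ with jumps $+k,+j,-k,-j$ at the rates $$\lambda^{(k)}_+=\lambda_1,\quad \lambda^{(j)}_+=\theta_2q_2,\quad \mu^{(k)}_+=\mu_{1,1}m_1+\mu_{1,2}z_{1,2}+\mu_{2,2}(m_2-z_{1,2})+\theta_1q_1,\quad \mu^{(j)}_+=\lambda_2$$ in states $n>0$, and $$\lambda^{(k)}_-=\lambda_1,\quad \lambda^{(j)}_-=\mu_{1,2}z_{1,2}+\mu_{2,2}(m_2-z_{1,2})+\theta_2q_2,\quad \mu^{(k)}_-=\mu_{1,1}m_1+\theta_1q_1,\quad \mu^{(j)}_-=\lambda_2$$ in states $n\le0$ (if $j=k$, the rates of equal jumps are added). Put $\delta_\pm(x)=j(\lambda^{(j)}_\pm-\mu^{(j)}_\pm)+k(\lambda^{(k)}_\pm-\mu^{(k)}_\pm)$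 and $\pi_{1,2}(x)=\lim_{s\to\infty}P(D(s)>0)$. Let $m=\max(j,k)$. Arrange $\mathbb Z$ in levels $L(n)=(nm+1,\dots,nm+m,\,-nm,-nm-1,\dots,-nm-(m-1))$, $n\ge0$, of $2m$ states each. The generator $Q$ of $D$ is then block tridiagonal. Let $B$, $A_0$, $A_1$, $A_2$ be its $2m\times2m$ blocks for the transitions, respectively, within $L(0)$, from $L(n)$ to $L(n+1)$ ($n\ge0$), within $L(n)$ ($n\ge1$), and from $L(n)$ to $L(n-1)$ ($n\ge1$). The rate matrix $R$ is the entrywise smallest nonnegative solution of $A_0+RA_1+R^2A_2=0$. **Theorem.** Assume that $\delta_+(x)<0<\delta_-(x)$ (so that $D$ is positive recurrent). Then the limit $\pi_{1,2}(x)$ exists, for every initial distribution of $D$ and independently of it, and the following hold. (a) If $r=1$, then $$\pi_{1,2}(x)=\frac{\delta_-(x)}{\delta_-(x)-\delta_+(x)}.$$ (b) For every rational $r=j/k$, the rate matrix $R$ exists and has the form $R=\begin{pmatrix}R^+&0\\0&R^-\end{pmatrix}$ with $m\times m$ blocks $R^\pm$ such that $I-R^\pm$ is invertible. There is exactly one row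 vector $\alpha_0=(\alpha_0^+,\alpha_0^-)$, with $\alpha_0^\pm$ of length $m$, that satisfies $\alpha_0(B+RA_2)=0$ and $\alpha_0\mathbf 1=1$. It is a positive multiple of the restriction to $L(0)$ of a stationary probability distribution of $D$, and $$\pi_{1,2}(x)=\frac{\alpha_0^+(I-R^+)^{-1}\mathbf 1}{\alpha_0^+(I-R^+)^{-1}\mathbf 1+\alpha_0^-(I-R^-)^{-1}\mathbf 1},$$ where the denominator is positive. -/

import Mathlib

open Filter Topology MeasureTheory
open scoped NNReal Matrix

universe u

noncomputable section

/-- Parameters of the overloaded Markovian X model: class-`i` arrival rates `lam`, abandonment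
rates `theta`, service rates `mu` (`mu12` is the rate of class 1 in pool 2), pool sizes `m1`, `m2`,
the shifting constant `kappa`, and a rational queue ratio `r = j / k` in lowest terms. -/
structure XModel where
  (lam1 lam2 theta1 theta2 mu11 mu12 mu22 m1 m2 kappa : ℝ)
  (j k : ℕ)
  lam1_pos : 0 < lam1
  lam2_pos : 0 < lam2
  theta1_pos : 0 < theta1
  theta2_pos : 0 < theta2
  mu11_pos : 0 < mu11
  mu12_pos : 0 < mu12
  mu22_pos : 0 < mu22
  m1_pos : 0 < m1
  m2_pos : 0 < m2
  kappa_nonneg : 0 ≤ kappa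
  j_pos : 0 < j
  k_pos : 0 < k
  coprime : j.Coprime k

/-- A fluid state `x = (q₁, q₂, z₁₂)`. -/
structure FluidState where
  (q1 q2 z12 : ℝ)

namespace XModel

variable (M : XModel) (x : FluidState)

/-- The queue ratio `r`. -/
def r : ℝ := (M.j : ℝ) / M.k

/-- The state space `[κ, ∞) × [0, ∞) × [0, m₂]`. -/
def InStateSpace : Prop :=
  M.kappa ≤ x.q1 ∧ 0 ≤ x.q2 ∧ 0 ≤ x.z12 ∧ x.z12 ≤ M.m2

/-- The part of the state space with `q₁ - r q₂ = κ`, where the averaging takes place. -/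
def OnBoundary : Prop :=
  M.InStateSpace x ∧ x.q1 - M.r * x.q2 = M.kappa

/-! ### Transition rates of the fast-time-scale process

The process is multiplied by `k`, so it lives on `ℤ` and jumps by `±j` and `±k`. A suffix `Pos`
refers to states `n > 0`, a suffix `Neg` to states `n ≤ 0`. Since class 1 is overloaded,
`z₁₁ = m₁`. -/

/-- Total service rate of pool 2. -/
def pool2Rate : ℝ := M.mu12 * x.z12 + M.mu22 * (M.m2 - x.z12)

/-- Rate of `+k` in positive states. -/
def upKPos : ℝ := M.lam1
/-- Rate of `+j` in positive states. -/
def upJPos : ℝ := M.theta2 * x.q2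
/-- Rate of `-k` in positive states. -/
def downKPos : ℝ := M.mu11 * M.m1 + M.pool2Rate x + M.theta1 * x.q1
/-- Rate of `-j` in positive states. -/
def downJPos : ℝ := M.lam2

/-- Rate of `+k` in nonpositive states. -/
def upKNeg : ℝ := M.lam1
/-- Rate of `+j` in nonpositive states. -/
def upJNeg : ℝ := M.pool2Rate x + M.theta2 * x.q2
/-- Rate of `-k` in nonpositive states. -/
def downKNeg : ℝ := M.mu11 * M.m1 + M.theta1 * x.q1
/-- Rate of `-j` in nonpositive states. -/
def downJNeg : ℝ := M.lam2

/-- The drift `δ₊` in the positive region. -/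
def driftPos : ℝ :=
  M.j * (M.upJPos x - M.downJPos) + M.k * (M.upKPos - M.downKPos x)

/-- The drift `δ₋` in the nonpositive region. -/
def driftNeg : ℝ :=
  M.j * (M.upJNeg x - M.downJNeg) + M.k * (M.upKNeg - M.downKNeg x)

/-- Rate of `+k` in state `n`. -/
def upK (n : ℤ) : ℝ := if 0 < n then M.upKPos else M.upKNeg
/-- Rate of `+j` in state `n`. -/
def upJ (n : ℤ) : ℝ := if 0 < n then M.upJPos x else M.upJNeg x
/-- Rate of `-k` in state `n`. -/
def downK (n : ℤ) : ℝ := if 0 < n then M.downKPos x else M.downKNeg x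
/-- Rate of `-j` in state `n`. -/
def downJ (n : ℤ) : ℝ := if 0 < n then M.downJPos else M.downJNeg

/-- The infinitesimal generator acting on functions: the sum over the four possible jumps of
`rate * (f (target) - f (current state))`. If `j = k`, the rates of equal jumps add up. -/
def genApply (f : ℤ → ℝ) (n : ℤ) : ℝ :=
  M.upK n * (f (n + M.k) - f n) + M.upJ x n * (f (n + M.j) - f n)
    + M.downK x n * (f (n - M.k) - f n) + M.downJ n * (f (n - M.j) - f n)

/-- The entry `Q(l, n)` of the generator matrix, i.e. the generator applied to the indicator
function of `{n}`, evaluated at `l`. -/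
def gen (l n : ℤ) : ℝ := M.genApply x (Set.indicator {n} 1) l

/-! ### The fast-time-scale process as a continuous-time Markov chain -/

/-- The transition semigroup `e^{sQ} f = ∑ sⁱ / i! • Qⁱ f` of the chain, for bounded `f`: the value
at `l` is the mean of `f (D s)` for the chain started in `D 0 = l`. The rates are bounded, so the
series converges absolutely, and no other chain has these rates. -/
def semigroup (s : ℝ) (f : ℤ → ℝ) (l : ℤ) : ℝ :=
  ∑' i : ℕ, s ^ i / (i.factorial : ℝ) * ((M.genApply x)^[i] f) l

/-- The probability that the chain started in `l` is in `A` at time `s`. -/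
def probIn (s : ℝ) (l : ℤ) (A : Set ℤ) : ℝ := M.semigroup x s (A.indicator 1) l

/-- `D` is a fast-time-scale process at `x`, i.e. a continuous-time Markov chain on `ℤ` with
generator `Q` and any initial distribution: given the past up to time `t`, it moves from `l` to `n`
during the next `h` time units with probability `e^{hQ}(l, n)`. No regularity of the paths is
needed, because only the one-dimensional marginals will be used. -/
structure IsFTSP {Ω : Type*} [MeasurableSpace Ω] (P : Measure Ω) (D : ℝ≥0 → Ω → ℤ) : Prop where
  measurable : ∀ t, Measurable (D t)
  markov : ∀ (t h : ℝ≥0) (F : Set Ω),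
    MeasurableSet[⨆ u : ℝ≥0, ⨆ _ : u ≤ t, MeasurableSpace.comap (D u) ⊤] F →
    ∀ l n : ℤ, P.real (F ∩ D t ⁻¹' {l} ∩ D (t + h) ⁻¹' {n})
      = P.real (F ∩ D t ⁻¹' {l}) * M.probIn x h l {n}

/-- `p` is the steady-state probability `π₁₂(x) = lim_{s → ∞} P(D(s) > 0)`: the limit exists and
equals `p` for the law of the chain started in any fixed state, and for every chain with any
initial distribution on any probability space. -/
def IsPi (p : ℝ) : Prop :=
  (∀ l : ℤ, Tendsto (fun s : ℝ => M.probIn x s l (Set.Ioi 0)) atTop (𝓝 p)) ∧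
  ∀ (Ω : Type u) [MeasurableSpace Ω] (P : Measure Ω) [IsProbabilityMeasure P]
    (D : ℝ≥0 → Ω → ℤ), M.IsFTSP x P D →
    Tendsto (fun s : ℝ≥0 => P.real {ω | 0 < D s ω}) atTop (𝓝 p)

/-- `α` is a stationary probability distribution of the chain: `α Q = 0` and `α 1 = 1`. -/
structure IsStationary (α : ℤ → ℝ) : Prop where
  nonneg : ∀ n, 0 ≤ α n
  hasSum_one : HasSum α 1
  balance : ∀ n, HasSum (fun l => α l * M.gen x l n) 0

/-! ### The quasi-birth-and-death representation -/

/-- The block size `m = max(j, k)`. -/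
def blk : ℕ := max M.j M.k

/-- The phases within a level: `m` positive ones, followed by `m` nonpositive ones. -/
abbrev Phase : Type := Fin M.blk ⊕ Fin M.blk

/-- The state of the chain at a given level and phase: level `n` is
`nm + 1, …, nm + m, -nm, -nm - 1, …, -nm - (m - 1)`. -/
def level (n : ℕ) : M.Phase → ℤ
  | Sum.inl i => n * M.blk + i + 1
  | Sum.inr i => -(n * M.blk) - i

/-- Transitions within level `0`. -/
def blockB : Matrix M.Phase M.Phase ℝ :=
  Matrix.of fun a b => M.gen x (M.level 0 a) (M.level 0 b)
/-- Transitions to the next higher level (the same from every level). -/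
def blockA0 : Matrix M.Phase M.Phase ℝ :=
  Matrix.of fun a b => M.gen x (M.level 0 a) (M.level 1 b)
/-- Transitions within a level other than `0` (the same for all of them). -/
def blockA1 : Matrix M.Phase M.Phase ℝ :=
  Matrix.of fun a b => M.gen x (M.level 1 a) (M.level 1 b)
/-- Transitions to the next lower level (the same from every level other than `0`). -/
def blockA2 : Matrix M.Phase M.Phase ℝ :=
  Matrix.of fun a b => M.gen x (M.level 1 a) (M.level 0 b)

/-- `R` is an entrywise nonnegative solution of `A₀ + R A₁ + R² A₂ = 0`. -/
def IsNonnegSolution (R : Matrix M.Phase M.Phase ℝ) : Prop :=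
  (∀ a b, 0 ≤ R a b) ∧ M.blockA0 x + R * M.blockA1 x + R ^ 2 * M.blockA2 x = 0

/-- `R` is the rate matrix: the entrywise least nonnegative solution of
`A₀ + R A₁ + R² A₂ = 0`. -/
def IsRateMatrix (R : Matrix M.Phase M.Phase ℝ) : Prop :=
  M.IsNonnegSolution x R ∧ ∀ R', M.IsNonnegSolution x R' → ∀ a b, R a b ≤ R' a b

/-- `a` is the boundary vector, renormalized to total mass one:
`a (B + R A₂) = 0` and `a 1 = 1`. -/
def IsBoundaryVector (R : Matrix M.Phase M.Phase ℝ) (a : M.Phase → ℝ) : Prop :=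
  a ᵥ* (M.blockB x + R * M.blockA2 x) = 0 ∧ a ⬝ᵥ 1 = 1

end XModel

/-- `a (I - S)⁻¹ 1`. -/
def blockMass {ι : Type*} [Fintype ι] [DecidableEq ι] (a : ι → ℝ) (S : Matrix ι ι ℝ) : ℝ :=
  (a ᵥ* (1 - S)⁻¹) ⬝ᵥ 1

end

namespace XModel

variable {M : XModel} {x : FluidState}

/-! Write `T` for the total jump rate, which is the same in all states, and `P = 1 + Q / (2T)` for
the lazy jump chain.

A stationary law `α` determines the limit. The energy `∑ α (Pⁱ f)²` decreases in `i`, and any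
pointwise limit `g` of `Pⁱ f` loses no energy under one more step. By strict positivity of variance
along possible jumps and by irreducibility (`j`, `k` coprime), `g` is constant, hence equal to the
`α`-mean of `f` (`IsStationary.tendsto_lazyStep_pow`). Since `e^{sQ}` is a Poisson average of the
powers of `P` (`semigroup_eq`), the limit passes to continuous time, and then to any initial law
(`IsStationary.isPi`).

For (a), stationarity tested on the identity function says that the mean drift is zero: `p δ₊ + (1 -
p) δ₋ = 0`, where `p` is the mass of the positive states.

For (b), the stationary law is constructed, so no recurrence criterion is needed. The drift signs
make a measure `ζ^|z|`, with `ζ < 1` close to `1`, superinvariant away from the origin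
(`exists_isGoodRatio`). On levels it gives a positive row vector `β` and `η = ζ^m < 1` for which the
monotone iteration towards `R` stays below `β R ≤ η β` (`Matrix.exists_least_solution`). So `R`
exists, its powers decay geometrically and `I - R` is invertible. It is block diagonal because `A₀`,
`A₁`, `A₂` do not link the two sides of the origin.

A row vector `a` with `a (B + R A₂) = 0` extends to the summable signed invariant measure `a Rⁿ`.
Such a measure vanishes or has a strict sign (`sign_of_invariant`), so a nonzero `a` has nonzero
total and at most one `a` has total one. One exists because `B + R A₂` has zero row sums and is
therefore singular. Normalizing `a Rⁿ` gives `α`, and Neumann series give the masses of the two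
half-lines. -/

/-! ### Signs and bounds of the rates. -/

theorem pool2Rate_pos (hx : M.InStateSpace x) : 0 < M.pool2Rate x := by
  obtain ⟨-, -, h0, h1⟩ := hx
  have := M.mu12_pos
  have := M.mu22_pos
  have := M.m2_pos
  unfold pool2Rate
  rcases h0.eq_or_lt with h | h
  · rw [← h]; simp only [mul_zero, zero_add, sub_zero]; positivity
  · have : 0 ≤ M.mu22 * (M.m2 - x.z12) := mul_nonneg (by positivity) (by linarith)
    have : 0 < M.mu12 * x.z12 := by positivity
    linarith

theorem upK_pos (n : ℤ) : 0 < M.upK n := by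
  have := M.lam1_pos
  unfold upK upKPos upKNeg; split_ifs <;> assumption

theorem downJ_pos (n : ℤ) : 0 < M.downJ n := by
  have := M.lam2_pos
  unfold downJ downJPos downJNeg; split_ifs <;> assumption

theorem upJ_nonneg (hx : M.InStateSpace x) (n : ℤ) : 0 ≤ M.upJ x n := by
  have h := pool2Rate_pos hx
  have := mul_nonneg M.theta2_pos.le hx.2.1
  unfold upJ upJPos upJNeg; split_ifs <;> linarith

theorem downK_pos (hx : M.InStateSpace x) (n : ℤ) : 0 < M.downK x n := by
  have h := pool2Rate_pos hx
  have := mul_nonneg M.theta1_pos.le (M.kappa_nonneg.trans hx.1)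
  have := mul_pos M.mu11_pos M.m1_pos
  unfold downK downKPos downKNeg; split_ifs <;> linarith

variable (M x) in
/-- The total jump rate, which is the same in all states. -/
noncomputable def totalRate : ℝ :=
  M.lam1 + M.lam2 + M.pool2Rate x + M.theta2 * x.q2 + M.mu11 * M.m1 + M.theta1 * x.q1

theorem sum_rates (n : ℤ) :
    M.upK n + M.upJ x n + M.downK x n + M.downJ n = M.totalRate x := by
  unfold upK upJ downK downJ totalRate upKPos upJPos downKPos downJPos upKNeg upJNeg downKNeg
    downJNeg
  split_ifs <;> ring

theorem totalRate_pos (hx : M.InStateSpace x) : 0 < M.totalRate x := by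
  rw [← sum_rates (M := M) (x := x) 0]
  have := upK_pos (M := M) 0
  have := downJ_pos (M := M) 0
  have := upJ_nonneg hx 0
  have := downK_pos hx 0
  linarith

theorem upK_le (hx : M.InStateSpace x) (n : ℤ) : M.upK n ≤ M.totalRate x := by
  linarith [sum_rates (M := M) (x := x) n, downJ_pos (M := M) n, upJ_nonneg hx n, downK_pos hx n]

theorem upJ_le (hx : M.InStateSpace x) (n : ℤ) : M.upJ x n ≤ M.totalRate x := by
  linarith [sum_rates (M := M) (x := x) n, downJ_pos (M := M) n, upK_pos (M := M) n,
    downK_pos hx n]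

theorem downK_le (hx : M.InStateSpace x) (n : ℤ) : M.downK x n ≤ M.totalRate x := by
  linarith [sum_rates (M := M) (x := x) n, downJ_pos (M := M) n, upK_pos (M := M) n,
    upJ_nonneg hx n]

theorem downJ_le (hx : M.InStateSpace x) (n : ℤ) : M.downJ n ≤ M.totalRate x := by
  linarith [sum_rates (M := M) (x := x) n, downK_pos hx n, upK_pos (M := M) n,
    upJ_nonneg hx n]

/-! ### The generator, its adjoint and their duality. -/

theorem genApply_eq (f : ℤ → ℝ) (n : ℤ) :
    M.genApply x f n = M.upK n * f (n + M.k) + M.upJ x n * f (n + M.j)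
      + M.downK x n * f (n - M.k) + M.downJ n * f (n - M.j) - M.totalRate x * f n := by
  rw [← sum_rates (M := M) (x := x) n]
  unfold genApply
  ring

variable (M x) in
/-- The adjoint of the generator, acting on (signed) measures `α` from the right: `α Q`. -/
noncomputable def genDual (α : ℤ → ℝ) (n : ℤ) : ℝ :=
  M.upK (n - M.k) * α (n - M.k) + M.upJ x (n - M.j) * α (n - M.j)
    + M.downK x (n + M.k) * α (n + M.k) + M.downJ (n + M.j) * α (n + M.j) - M.totalRate x * α n

theorem gen_eq (l n : ℤ) :
    M.gen x l n = (if l = n - M.k then M.upK l else 0) + (if l = n - M.j then M.upJ x l else 0)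
      + (if l = n + M.k then M.downK x l else 0) + (if l = n + M.j then M.downJ l else 0)
      - (if l = n then M.totalRate x else 0) := by
  have h1 : (l = n - M.k) ↔ (l + M.k = n) := by omega
  have h2 : (l = n - M.j) ↔ (l + M.j = n) := by omega
  have h3 : (l = n + M.k) ↔ (l - M.k = n) := by omega
  have h4 : (l = n + M.j) ↔ (l - M.j = n) := by omega
  simp only [gen, genApply_eq, Set.indicator_apply, Set.mem_singleton_iff, Pi.one_apply, h1, h2, h3,
    h4, mul_ite, mul_one, mul_zero]

theorem _root_.HasSum.congr_terms {ι : Type*} {f g : ι → ℝ} {s : ℝ} (hg : HasSum g s)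
    (h : ∀ l, f l = g l) : HasSum f s :=
  (funext h : f = g) ▸ hg

theorem hasSum_mul_gen (α : ℤ → ℝ) (n : ℤ) :
    HasSum (fun l => α l * M.gen x l n) (M.genDual x α n) := by
  have key : ∀ (c : ℤ) (g : ℤ → ℝ),
      HasSum (fun l => if l = c then α l * g l else 0) (g c * α c) := by
    intro c g
    convert hasSum_ite_eq c (g c * α c) using 2 with l
    split_ifs with h
    · rw [h, mul_comm]
    · rfl
  have h := (((((key (n - M.k) M.upK).add (key (n - M.j) (M.upJ x))).add
    (key (n + M.k) (M.downK x))).add (key (n + M.j) M.downJ)).sub (key n fun _ => M.totalRate x))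
  refine h.congr_terms fun l => ?_
  rw [gen_eq]
  simp only [mul_add, mul_sub, mul_ite, mul_zero]

theorem genDual_eq_zero_iff {α : ℤ → ℝ} {n : ℤ} :
    HasSum (fun l => α l * M.gen x l n) 0 ↔ M.genDual x α n = 0 :=
  ⟨fun h => (hasSum_mul_gen α n).unique h, fun h => h ▸ hasSum_mul_gen α n⟩

theorem summable_mul_bounded {ι : Type*} {α g : ι → ℝ} {C : ℝ} (hα : Summable α)
    (hg : ∀ l, |g l| ≤ C) :
    Summable fun l => α l * g l := by
  refine Summable.of_norm_bounded (g := fun l => |α l| * C) (hα.abs.mul_right C) fun l => ?_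
  rw [Real.norm_eq_abs, abs_mul]
  exact mul_le_mul_of_nonneg_left (hg l) (abs_nonneg _)

/-- Duality between the generator and its adjoint. -/
theorem tsum_mul_genApply (hx : M.InStateSpace x) {α f : ℤ → ℝ} {C : ℝ} (hα : Summable α)
    (hf : ∀ l, |f l| ≤ C) :
    Summable (fun l => α l * M.genApply x f l) ∧ Summable (fun n => M.genDual x α n * f n) ∧
    ∑' l, α l * M.genApply x f l = ∑' n, M.genDual x α n * f n := by
  have key : ∀ (c : ℤ) (g : ℤ → ℝ), (∀ l, 0 ≤ g l) → (∀ l, g l ≤ M.totalRate x) →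
      ∃ s, HasSum (fun l => α l * g l * f (l + c)) s ∧
        HasSum (fun n => α (n - c) * g (n - c) * f n) s := by
    intro c g h0 h1
    have hs : Summable fun l => α l * (g l * f (l + c)) := by
      refine summable_mul_bounded (C := M.totalRate x * C) hα fun l => ?_
      rw [abs_mul, abs_of_nonneg (h0 l)]
      exact mul_le_mul (h1 l) (hf _) (abs_nonneg _) ((h0 l).trans (h1 l))
    have hs' : HasSum (fun l => α l * g l * f (l + c)) (∑' l, α l * (g l * f (l + c))) := by
      simpa only [mul_assoc] using hs.hasSum
    refine ⟨_, hs', ?_⟩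
    rw [← (Equiv.addRight c).hasSum_iff]
    convert hs' using 2 with l
    simp
  obtain ⟨s1, a1, b1⟩ := key M.k M.upK (fun l => (upK_pos l).le) (upK_le hx)
  obtain ⟨s2, a2, b2⟩ := key M.j (M.upJ x) (upJ_nonneg hx) (upJ_le hx)
  obtain ⟨s3, a3, b3⟩ := key (-M.k) (M.downK x) (fun l => (downK_pos hx l).le) (downK_le hx)
  obtain ⟨s4, a4, b4⟩ := key (-M.j) M.downJ (fun l => (downJ_pos l).le) (downJ_le hx)
  obtain ⟨s5, a5, b5⟩ := key 0 (fun _ => M.totalRate x) (fun _ => (totalRate_pos hx).le)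
    (fun _ => le_rfl)
  have hA : HasSum (fun l => α l * M.genApply x f l) (s1 + s2 + s3 + s4 - s5) := by
    refine HasSum.congr_terms ((((a1.add a2).add a3).add a4).sub a5) fun l => ?_
    rw [genApply_eq, add_zero, ← sub_eq_add_neg, ← sub_eq_add_neg]
    ring
  have hB : HasSum (fun n => M.genDual x α n * f n) (s1 + s2 + s3 + s4 - s5) := by
    refine HasSum.congr_terms ((((b1.add b2).add b3).add b4).sub b5) fun l => ?_
    rw [genDual, sub_neg_eq_add, sub_neg_eq_add, sub_zero]
    ring
  exact ⟨hA.summable, hB.summable, hA.tsum_eq.trans hB.tsum_eq.symm⟩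

/-! ### Irreducibility and the sign of invariant measures. -/

/-- Since `j` and `k` are coprime, all states communicate through jumps `-k`, `+k`, `+j`. -/
theorem mem_of_closed {S : Set ℤ} {n₀ : ℤ} (h0 : n₀ ∈ S) (hk : ∀ n ∈ S, n + M.k ∈ S)
    (hk' : ∀ n ∈ S, n - M.k ∈ S) (hj : ∀ n ∈ S, n + M.j ∈ S) (n : ℤ) : n ∈ S := by
  have h1 : ∀ (a : ℕ), ∀ n ∈ S, n + a * M.k ∈ S := by
    intro a
    induction a with
    | zero => intro n hn; simpa using hn
    | succ a ih =>
      intro n hn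
      have := hk _ (ih n hn)
      convert this using 1; push_cast; ring
  have h2 : ∀ (a : ℕ), ∀ n ∈ S, n - a * M.k ∈ S := by
    intro a
    induction a with
    | zero => intro n hn; simpa using hn
    | succ a ih =>
      intro n hn
      have := hk' _ (ih n hn)
      convert this using 1; push_cast; ring
  have h3 : ∀ (a : ℕ), ∀ n ∈ S, n + a * M.j ∈ S := by
    intro a
    induction a with
    | zero => intro n hn; simpa using hn
    | succ a ih =>
      intro n hn
      have := hj _ (ih n hn)
      convert this using 1; push_cast; ring
  have h4 : ∀ (b : ℤ), ∀ n ∈ S, n + b * M.k ∈ S := by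
    intro b n hn
    obtain ⟨a, rfl | rfl⟩ := b.eq_nat_or_neg
    · exact h1 a n hn
    · have := h2 a n hn
      convert this using 1; ring
  have hbez : (M.j : ℤ) * M.j.gcdA M.k + M.k * M.j.gcdB M.k = 1 := by
    rw [← Nat.gcd_eq_gcd_ab, M.coprime]; rfl
  have hk0 : (0 : ℤ) < M.k := by exact_mod_cast M.k_pos
  set d := n - n₀
  set u := M.j.gcdA M.k
  set v := M.j.gcdB M.k
  -- Only forward steps of size `j` are available, so the Bézout coefficient of `j` is reduced
  -- modulo `k` to be nonnegative; multiples of `k`, allowed in both directions, absorb the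
  -- difference.
  have ha : 0 ≤ (d * u) % M.k := Int.emod_nonneg _ hk0.ne'
  obtain ⟨a, ha⟩ := Int.eq_ofNat_of_zero_le ha
  have := h4 (d * v + M.j * ((d * u) / M.k)) _ (h3 a _ h0)
  convert this using 1
  rw [← ha]
  have e := Int.emod_add_mul_ediv (d * u) M.k
  have : n = n₀ + d := by ring
  linear_combination this - d * hbez - M.j * e

/-- A nonnegative invariant measure is zero or positive everywhere. -/
theorem pos_of_invariant (hx : M.InStateSpace x) {β : ℤ → ℝ} (h0 : ∀ n, 0 ≤ β n)
    (hβ : ∀ n, M.genDual x β n = 0) {n₀ : ℤ} (hn₀ : 0 < β n₀) (n : ℤ) : 0 < β n := by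
  -- Balance at a zero of `β` kills every inflow. The predecessor `n - j` is left out because `upJ`
  -- may vanish, namely when `q₂ = 0`.
  have step : ∀ n, β n = 0 → β (n - M.k) = 0 ∧ β (n + M.k) = 0 ∧ β (n + M.j) = 0 := by
    intro n hn
    have h := hβ n
    rw [genDual, hn, mul_zero, sub_zero] at h
    have p1 := mul_nonneg (upK_pos (M := M) (n - M.k)).le (h0 (n - M.k))
    have p2 := mul_nonneg (upJ_nonneg hx (n - M.j)) (h0 (n - M.j))
    have p3 := mul_nonneg (downK_pos hx (n + M.k)).le (h0 (n + M.k))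
    have p4 := mul_nonneg (downJ_pos (M := M) (n + M.j)).le (h0 (n + M.j))
    have q1 : M.upK (n - M.k) * β (n - M.k) = 0 := by linarith
    have q3 : M.downK x (n + M.k) * β (n + M.k) = 0 := by linarith
    have q4 : M.downJ (n + M.j) * β (n + M.j) = 0 := by linarith
    exact ⟨(mul_eq_zero.1 q1).resolve_left (upK_pos _).ne',
      (mul_eq_zero.1 q3).resolve_left (downK_pos hx _).ne',
      (mul_eq_zero.1 q4).resolve_left (downJ_pos _).ne'⟩
  refine (h0 n).lt_of_ne' fun hn => hn₀.ne' ?_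
  exact mem_of_closed (M := M) (S := {n | β n = 0}) hn (fun n hn => (step n hn).2.1)
    (fun n hn => (step n hn).1) (fun n hn => (step n hn).2.2) n₀

/-- A summable signed invariant measure has constant strict sign or vanishes. -/
theorem sign_of_invariant (hx : M.InStateSpace x) {α : ℤ → ℝ} (hs : Summable α)
    (hα : ∀ n, M.genDual x α n = 0) :
    (∀ n, α n = 0) ∨ (∀ n, 0 < α n) ∨ (∀ n, α n < 0) := by
  have hT := totalRate_pos hx
  -- Triangle inequality in the balance equation of `α`.
  have hsub : ∀ n, 0 ≤ M.genDual x (fun l => |α l|) n := by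
    intro n
    have h := hα n
    rw [genDual, sub_eq_zero] at h
    have h' := congrArg abs h
    rw [abs_mul, abs_of_pos hT] at h'
    rw [genDual, ← h', sub_nonneg]
    refine (abs_add_le _ _).trans (add_le_add ((abs_add_le _ _).trans (add_le_add
      ((abs_add_le _ _).trans (add_le_add ?_ ?_)) ?_)) ?_)
    · rw [abs_mul, abs_of_pos (upK_pos _)]
    · rw [abs_mul, abs_of_nonneg (upJ_nonneg hx _)]
    · rw [abs_mul, abs_of_pos (downK_pos hx _)]
    · rw [abs_mul, abs_of_pos (downJ_pos _)]
  -- Duality with the constant function `1`, which `Q` annihilates, shows that these nonnegative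
  -- numbers sum to zero. Hence `|α|` is invariant too, and so is `|α| - α ≥ 0`.
  have habs : ∀ n, M.genDual x (fun l => |α l|) n = 0 := by
    obtain ⟨-, h2, h3⟩ := tsum_mul_genApply (f := fun _ => 1) (C := 1) hx hs.abs (by simp)
    simp only [genApply, sub_self, mul_zero, add_zero, tsum_zero, mul_one] at h2 h3
    have := (hasSum_zero_iff_of_nonneg hsub).1 (h3 ▸ h2.hasSum)
    exact fun n => congrFun this n
  by_cases h1 : ∃ n, |α n| - α n > 0
  · obtain ⟨n₀, hn₀⟩ := h1
    right; right
    have := pos_of_invariant (β := fun n => |α n| - α n) hx (fun n => sub_nonneg.2 (le_abs_self _))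
      (fun n => by
        have h1 := habs n; have h2 := hα n
        simp only [genDual] at h1 h2 ⊢
        linear_combination h1 - h2) hn₀
    intro n
    have := this n
    by_contra! h
    rw [abs_of_nonneg h, sub_self] at this
    exact this.false
  · push Not at h1
    have h0 : ∀ n, 0 ≤ α n := fun n => (abs_nonneg _).trans (by linarith [h1 n])
    by_cases h2 : ∃ n, 0 < α n
    · obtain ⟨n₀, hn₀⟩ := h2
      exact Or.inr (Or.inl (pos_of_invariant hx h0 hα hn₀))
    · push Not at h2
      exact Or.inl fun n => le_antisymm (h2 n) (h0 n)

/-! ### Convergence of the lazy jump chain to equilibrium. -/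

variable (M x) in
/-- The generator as a linear map. -/
def genLin : Module.End ℝ (ℤ → ℝ) where
  toFun := M.genApply x
  map_add' f g := by ext n; simp only [genApply, Pi.add_apply]; ring
  map_smul' c f := by
    ext n; simp only [genApply, Pi.smul_apply, smul_eq_mul, RingHom.id_apply]; ring

@[simp] theorem genLin_apply (f : ℤ → ℝ) : M.genLin x f = M.genApply x f := rfl

variable (M x) in
/-- The transition operator `1 + Q / (2T)` of the uniformized lazy jump chain. -/
noncomputable def lazyStep : Module.End ℝ (ℤ → ℝ) := 1 + (2 * M.totalRate x)⁻¹ • M.genLin x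

theorem lazyStep_apply (f : ℤ → ℝ) (l : ℤ) :
    M.lazyStep x f l = f l + (2 * M.totalRate x)⁻¹ * M.genApply x f l := rfl

/-- The holding weight `1 / 2` is the purpose of the factor `2` in `lazyStep`: it rules out
periodicity and allows each jump to be compared with staying put. -/
theorem lazyStep_eq (hx : M.InStateSpace x) (f : ℤ → ℝ) (l : ℤ) :
    M.lazyStep x f l = 1 / 2 * f l + M.upK l / (2 * M.totalRate x) * f (l + M.k)
      + M.upJ x l / (2 * M.totalRate x) * f (l + M.j)
      + M.downK x l / (2 * M.totalRate x) * f (l - M.k)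
      + M.downJ l / (2 * M.totalRate x) * f (l - M.j) := by
  have := totalRate_pos hx
  rw [lazyStep_apply, genApply_eq]
  field_simp
  ring

theorem sum_weights (hx : M.InStateSpace x) (l : ℤ) :
    1 / 2 + M.upK l / (2 * M.totalRate x) + M.upJ x l / (2 * M.totalRate x)
      + M.downK x l / (2 * M.totalRate x) + M.downJ l / (2 * M.totalRate x) = 1 := by
  have := totalRate_pos hx
  have h := sum_rates (M := M) (x := x) l
  field_simp
  linarith

/-- The variance of a five-point distribution dominates its squared differences to the first
point. -/
theorem five_point_variance {w0 w1 w2 w3 w4 : ℝ} (h : w0 + w1 + w2 + w3 + w4 = 1) (h0 : 0 ≤ w0)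
    (h1 : 0 ≤ w1) (h2 : 0 ≤ w2) (h3 : 0 ≤ w3) (h4 : 0 ≤ w4) (a0 a1 a2 a3 a4 : ℝ) :
    w0 * w1 * (a0 - a1) ^ 2 + w0 * w3 * (a0 - a3) ^ 2 + w0 * w4 * (a0 - a4) ^ 2 ≤
      (w0 * a0 ^ 2 + w1 * a1 ^ 2 + w2 * a2 ^ 2 + w3 * a3 ^ 2 + w4 * a4 ^ 2)
        - (w0 * a0 + w1 * a1 + w2 * a2 + w3 * a3 + w4 * a4) ^ 2 := by
  -- The variance is the sum of `wᵢ wⱼ (aᵢ - aⱼ)²` over all pairs. Three pairs are kept; the pair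
  -- `(0, 2)` stands for the jump `+j`, whose rate may vanish.
  have e : (w0 * a0 ^ 2 + w1 * a1 ^ 2 + w2 * a2 ^ 2 + w3 * a3 ^ 2 + w4 * a4 ^ 2)
        - (w0 * a0 + w1 * a1 + w2 * a2 + w3 * a3 + w4 * a4) ^ 2
      - (w0 * w1 * (a0 - a1) ^ 2 + w0 * w3 * (a0 - a3) ^ 2 + w0 * w4 * (a0 - a4) ^ 2)
      = w0 * w2 * (a0 - a2) ^ 2 + w1 * w2 * (a1 - a2) ^ 2 + w1 * w3 * (a1 - a3) ^ 2
        + w1 * w4 * (a1 - a4) ^ 2 + w2 * w3 * (a2 - a3) ^ 2 + w2 * w4 * (a2 - a4) ^ 2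
        + w3 * w4 * (a3 - a4) ^ 2 := by
    obtain rfl : w0 = 1 - (w1 + w2 + w3 + w4) := by linarith
    ring
  have : 0 ≤ w0 * w2 * (a0 - a2) ^ 2 + w1 * w2 * (a1 - a2) ^ 2 + w1 * w3 * (a1 - a3) ^ 2
        + w1 * w4 * (a1 - a4) ^ 2 + w2 * w3 * (a2 - a3) ^ 2 + w2 * w4 * (a2 - a4) ^ 2
        + w3 * w4 * (a3 - a4) ^ 2 := by positivity
  linarith

theorem lazyStep_variance (hx : M.InStateSpace x) (f : ℤ → ℝ) (l : ℤ) :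
    1 / 2 * (M.upK l / (2 * M.totalRate x)) * (f l - f (l + M.k)) ^ 2
      + 1 / 2 * (M.downK x l / (2 * M.totalRate x)) * (f l - f (l - M.k)) ^ 2
      + 1 / 2 * (M.downJ l / (2 * M.totalRate x)) * (f l - f (l - M.j)) ^ 2
    ≤ M.lazyStep x (fun n => f n ^ 2) l - M.lazyStep x f l ^ 2 := by
  have hT := totalRate_pos hx
  rw [lazyStep_eq hx, lazyStep_eq hx]
  exact five_point_variance (sum_weights hx l) (by norm_num)
    (div_nonneg (upK_pos l).le (by positivity)) (div_nonneg (upJ_nonneg hx l) (by positivity))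
    (div_nonneg (downK_pos hx l).le (by positivity))
    (div_nonneg (downJ_pos l).le (by positivity)) _ _ _ _ _

theorem lazyStep_sq_le (hx : M.InStateSpace x) (f : ℤ → ℝ) (l : ℤ) :
    M.lazyStep x f l ^ 2 ≤ M.lazyStep x (fun n => f n ^ 2) l := by
  have hT := totalRate_pos hx
  have h1 := upK_pos (M := M) l
  have h2 := downK_pos hx l
  have h3 := downJ_pos (M := M) l
  have := lazyStep_variance hx f l
  have : 0 ≤ 1 / 2 * (M.upK l / (2 * M.totalRate x)) * (f l - f (l + M.k)) ^ 2
      + 1 / 2 * (M.downK x l / (2 * M.totalRate x)) * (f l - f (l - M.k)) ^ 2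
      + 1 / 2 * (M.downJ l / (2 * M.totalRate x)) * (f l - f (l - M.j)) ^ 2 := by positivity
  linarith

theorem abs_lazyStep_le (hx : M.InStateSpace x) {f : ℤ → ℝ} {C : ℝ} (hf : ∀ l, |f l| ≤ C)
    (l : ℤ) : |M.lazyStep x f l| ≤ C := by
  have hT := totalRate_pos hx
  have key : ∀ w a : ℝ, 0 ≤ w → |a| ≤ C → |w * a| ≤ w * C := fun w a hw ha => by
    rw [abs_mul, abs_of_nonneg hw]; exact mul_le_mul_of_nonneg_left ha hw
  have h := sum_weights hx l
  rw [lazyStep_eq hx]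
  calc _ ≤ 1 / 2 * C + M.upK l / (2 * M.totalRate x) * C + M.upJ x l / (2 * M.totalRate x) * C
      + M.downK x l / (2 * M.totalRate x) * C + M.downJ l / (2 * M.totalRate x) * C := by
        refine (abs_add_le _ _).trans (add_le_add ((abs_add_le _ _).trans (add_le_add
          ((abs_add_le _ _).trans (add_le_add ((abs_add_le _ _).trans (add_le_add ?_ ?_))
            ?_)) ?_)) ?_)
        · exact key _ _ (by norm_num) (hf _)
        · exact key _ _ (div_nonneg (upK_pos l).le (by positivity)) (hf _)
        · exact key _ _ (div_nonneg (upJ_nonneg hx l) (by positivity)) (hf _)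
        · exact key _ _ (div_nonneg (downK_pos hx l).le (by positivity)) (hf _)
        · exact key _ _ (div_nonneg (downJ_pos l).le (by positivity)) (hf _)
    _ = C := by rw [← add_mul, ← add_mul, ← add_mul, ← add_mul, h, one_mul]

theorem abs_lazyStep_pow_le (hx : M.InStateSpace x) {f : ℤ → ℝ} {C : ℝ} (hf : ∀ l, |f l| ≤ C)
    (i : ℕ) : ∀ l, |(M.lazyStep x ^ i) f l| ≤ C := by
  induction i with
  | zero => exact hf
  | succ i ih =>
    intro l
    rw [pow_succ']
    exact abs_lazyStep_le hx ih l

/-- Each value of `Q f` involves only finitely many values of `f`, so pointwise convergence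
suffices, along any filter. -/
theorem tendsto_genApply {ι : Type*} {𝓕 : Filter ι} {F : ι → ℤ → ℝ} {g : ℤ → ℝ}
    (h : ∀ l, Tendsto (fun i => F i l) 𝓕 (𝓝 (g l))) (l : ℤ) :
    Tendsto (fun i => M.genApply x (F i) l) 𝓕 (𝓝 (M.genApply x g l)) :=
  ((((((h _).sub (h _)).const_mul _).add (((h _).sub (h _)).const_mul _)).add
    (((h _).sub (h _)).const_mul _)).add (((h _).sub (h _)).const_mul _))

theorem tendsto_lazyStep {ι : Type*} {𝓕 : Filter ι} {F : ι → ℤ → ℝ} {g : ℤ → ℝ}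
    (h : ∀ l, Tendsto (fun i => F i l) 𝓕 (𝓝 (g l))) (l : ℤ) :
    Tendsto (fun i => M.lazyStep x (F i) l) 𝓕 (𝓝 (M.lazyStep x g l)) :=
  (h l).add ((tendsto_genApply h l).const_mul _)

theorem IsStationary.summable {α : ℤ → ℝ} (hα : M.IsStationary x α) : Summable α :=
  hα.hasSum_one.summable

theorem IsStationary.genDual_eq_zero {α : ℤ → ℝ} (hα : M.IsStationary x α) (n : ℤ) :
    M.genDual x α n = 0 :=
  genDual_eq_zero_iff.1 (hα.balance n)

theorem IsStationary.pos (hx : M.InStateSpace x) {α : ℤ → ℝ} (hα : M.IsStationary x α) (n : ℤ) :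
    0 < α n := by
  obtain ⟨n₀, hn₀⟩ : ∃ n₀, 0 < α n₀ := by
    by_contra! h
    have h0 : α = fun _ => 0 := funext fun n => le_antisymm (h n) (hα.nonneg n)
    have := hα.hasSum_one
    rw [h0] at this
    exact zero_ne_one (hasSum_zero.unique this)
  exact pos_of_invariant hx hα.nonneg hα.genDual_eq_zero hn₀ n

theorem IsStationary.tsum_mul_genApply (hx : M.InStateSpace x) {α f : ℤ → ℝ} {C : ℝ}
    (hα : M.IsStationary x α) (hf : ∀ l, |f l| ≤ C) :
    Summable (fun l => α l * M.genApply x f l) ∧ ∑' l, α l * M.genApply x f l = 0 := by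
  obtain ⟨h1, -, h3⟩ := XModel.tsum_mul_genApply hx hα.summable hf
  refine ⟨h1, h3.trans ?_⟩
  simp [hα.genDual_eq_zero]

theorem IsStationary.tsum_mul_lazyStep (hx : M.InStateSpace x) {α f : ℤ → ℝ} {C : ℝ}
    (hα : M.IsStationary x α) (hf : ∀ l, |f l| ≤ C) :
    ∑' l, α l * M.lazyStep x f l = ∑' l, α l * f l := by
  obtain ⟨h1, h2⟩ := hα.tsum_mul_genApply hx hf
  have : ∀ l, α l * M.lazyStep x f l
      = α l * f l + (2 * M.totalRate x)⁻¹ * (α l * M.genApply x f l) := fun l => by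
    rw [lazyStep_apply]; ring
  simp_rw [this]
  rw [(summable_mul_bounded hα.summable hf).tsum_add (h1.mul_left _), tsum_mul_left, h2, mul_zero,
    add_zero]

theorem IsStationary.tsum_mul_lazyStep_pow (hx : M.InStateSpace x) {α f : ℤ → ℝ} {C : ℝ}
    (hα : M.IsStationary x α) (hf : ∀ l, |f l| ≤ C) (i : ℕ) :
    ∑' l, α l * (M.lazyStep x ^ i) f l = ∑' l, α l * f l := by
  induction i with
  | zero => rfl
  | succ i ih =>
    rw [pow_succ', ← ih]
    exact hα.tsum_mul_lazyStep hx (abs_lazyStep_pow_le hx hf i)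

theorem tendsto_tsum_mul {ι : Type*} {𝓕 : Filter ι} {α g : ℤ → ℝ} {F : ι → ℤ → ℝ} {C : ℝ}
    (hα : Summable α) (hF : ∀ i l, |F i l| ≤ C) (h : ∀ l, Tendsto (fun i => F i l) 𝓕 (𝓝 (g l))) :
    Tendsto (fun i => ∑' l, α l * F i l) 𝓕 (𝓝 (∑' l, α l * g l)) := by
  refine tendsto_tsum_of_dominated_convergence (hα.abs.mul_right C)
    (fun l => (h l).const_mul _) (Eventually.of_forall fun i l => ?_)
  rw [Real.norm_eq_abs, abs_mul]
  exact mul_le_mul_of_nonneg_left (hF i l) (abs_nonneg _)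

/-- A bounded function that does not lose variance in one step of the lazy chain is constant. -/
theorem IsStationary.const_of_tsum_sq_eq (hx : M.InStateSpace x) {α g : ℤ → ℝ} {C : ℝ}
    (hα : M.IsStationary x α) (hg : ∀ l, |g l| ≤ C)
    (h : ∑' l, α l * M.lazyStep x g l ^ 2 = ∑' l, α l * g l ^ 2) (l n : ℤ) : g l = g n := by
  have hsq : ∀ l, |g l ^ 2| ≤ C ^ 2 := fun l => by
    rw [abs_pow]; exact pow_le_pow_left₀ (abs_nonneg _) (hg l) 2
  have hPsq : ∀ l, |M.lazyStep x g l ^ 2| ≤ C ^ 2 := fun l => by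
    rw [abs_pow]; exact pow_le_pow_left₀ (abs_nonneg _) (abs_lazyStep_le hx hg l) 2
  have hs1 := summable_mul_bounded hα.summable (abs_lazyStep_le hx hsq)
  have hs2 := summable_mul_bounded hα.summable hPsq
  have hsum := (hs1.sub hs2).hasSum
  -- By stationarity the `α`-mean of `P(g²) - (P g)²` is zero. Its terms are nonnegative and `α >
  -- 0`, so the one-step variance vanishes in every state.
  rw [hs1.tsum_sub hs2, hα.tsum_mul_lazyStep hx hsq, h, sub_self,
    hasSum_zero_iff_of_nonneg (fun l => sub_nonneg.2
      (mul_le_mul_of_nonneg_left (lazyStep_sq_le hx g l) (hα.nonneg l)))] at hsum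
  have step : ∀ l, g (l + M.k) = g l ∧ g (l - M.k) = g l ∧ g (l - M.j) = g l := by
    intro l
    have h0 := congrFun hsum l
    simp only [Pi.zero_apply] at h0
    rw [← mul_sub] at h0
    have h0 := (mul_eq_zero.1 h0).resolve_left (hα.pos hx l).ne'
    have hv := lazyStep_variance hx g l
    rw [h0] at hv
    have hT := totalRate_pos hx
    have h1 := upK_pos (M := M) l
    have h2 := downK_pos hx l
    have h3 := downJ_pos (M := M) l
    have aux : ∀ {c a b : ℝ}, 0 < c → 1 / 2 * (c / (2 * M.totalRate x)) * (a - b) ^ 2 = 0 →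
        b = a := by
      intro c a b hc h
      have hne : 1 / 2 * (c / (2 * M.totalRate x)) ≠ 0 := by positivity
      have := pow_eq_zero_iff (two_ne_zero) |>.1 ((mul_eq_zero.1 h).resolve_left hne)
      linarith
    have p1 : 0 ≤ 1 / 2 * (M.upK l / (2 * M.totalRate x)) * (g l - g (l + M.k)) ^ 2 := by
      positivity
    have p2 : 0 ≤ 1 / 2 * (M.downK x l / (2 * M.totalRate x)) * (g l - g (l - M.k)) ^ 2 := by
      positivity
    have p3 : 0 ≤ 1 / 2 * (M.downJ l / (2 * M.totalRate x)) * (g l - g (l - M.j)) ^ 2 := by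
      positivity
    exact ⟨aux h1 (by linarith), aux h2 (by linarith), aux h3 (by linarith)⟩
  refine mem_of_closed (M := M) (S := {l | g l = g n}) (n₀ := n) rfl
    (fun l hl => (step l).1.trans hl) (fun l hl => (step l).2.1.trans hl) (fun l hl => ?_) l
  -- Invariance under `+j` is read off from the jump `-j` out of `l + j`, whose rate is positive.
  have := (step (l + M.j)).2.2
  rw [add_sub_cancel_right] at this
  exact this.symm.trans hl

/-- The lazy jump chain converges to equilibrium. -/
theorem IsStationary.tendsto_lazyStep_pow (hx : M.InStateSpace x) {α f : ℤ → ℝ} {C : ℝ}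
    (hα : M.IsStationary x α) (hf : ∀ l, |f l| ≤ C) (l : ℤ) :
    Tendsto (fun i => (M.lazyStep x ^ i) f l) atTop (𝓝 (∑' n, α n * f n)) := by
  have hb := fun i => abs_lazyStep_pow_le hx hf i
  have hbsq : ∀ i l, |(M.lazyStep x ^ i) f l ^ 2| ≤ C ^ 2 := fun i l => by
    rw [abs_pow]; exact pow_le_pow_left₀ (abs_nonneg _) (hb i l) 2
  set E : ℕ → ℝ := fun i => ∑' l, α l * (M.lazyStep x ^ i) f l ^ 2 with hE
  have hanti : Antitone E := by
    refine antitone_nat_of_succ_le fun i => ?_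
    rw [hE]
    dsimp only
    rw [← hα.tsum_mul_lazyStep hx (hbsq i)]
    refine (summable_mul_bounded hα.summable (hbsq _)).tsum_le_tsum (fun l => ?_)
      (summable_mul_bounded hα.summable (abs_lazyStep_le hx (hbsq i)))
    refine mul_le_mul_of_nonneg_left ?_ (hα.nonneg l)
    rw [pow_succ' (M.lazyStep x)]
    exact lazyStep_sq_le hx _ l
  have hElim := tendsto_atTop_ciInf hanti ⟨0, by
    rintro _ ⟨i, rfl⟩
    exact tsum_nonneg fun l => mul_nonneg (hα.nonneg l) (sq_nonneg _)⟩
  -- Along an ultrafilter the bounded sequences converge in all states at once, which replaces a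
  -- diagonal subsequence.
  rw [tendsto_iff_ultrafilter]
  intro U hU
  have hlim : ∀ n, ∃ g, |g| ≤ C ∧ Tendsto (fun i => (M.lazyStep x ^ i) f n) U (𝓝 g) := by
    intro n
    obtain ⟨g, hg, hg'⟩ := (isCompact_Icc (a := -C) (b := C)).ultrafilter_le_nhds'
      (U.map fun i => (M.lazyStep x ^ i) f n)
      (Filter.univ_mem' (f := (U : Filter ℕ)) fun i => abs_le.1 (hb i n))
    exact ⟨g, abs_le.2 hg, hg'⟩
  choose g hgC hg using hlim
  have h1 := tendsto_tsum_mul hα.summable hbsq (fun n => (hg n).pow 2)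
  have hg1 : ∀ n, Tendsto (fun i => (M.lazyStep x ^ (i + 1)) f n) U (𝓝 (M.lazyStep x g n)) := by
    intro n
    simp_rw [pow_succ']
    exact tendsto_lazyStep hg n
  have h2 := tendsto_tsum_mul hα.summable (fun i => hbsq (i + 1)) (fun n => (hg1 n).pow 2)
  have e1 := tendsto_nhds_unique h1 (hElim.mono_left hU)
  have e2 := tendsto_nhds_unique h2 ((hElim.comp (tendsto_add_atTop_nat 1)).mono_left hU)
  -- Both `g` and `P g` have the limiting energy, so `g` is constant; conservation of the mean then
  -- identifies the constant.
  have hconst := hα.const_of_tsum_sq_eq hx hgC (e2.trans e1.symm)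
  have h3 := tendsto_tsum_mul hα.summable hb hg
  simp_rw [hα.tsum_mul_lazyStep_pow hx hf, hconst _ l] at h3
  rw [tsum_mul_right, hα.hasSum_one.tsum_eq, one_mul] at h3
  rw [tendsto_nhds_unique tendsto_const_nhds h3]
  exact hg l

end XModel

/-! ### Poisson averages. -/

theorem summable_pow_div_factorial_mul (t : ℝ) {u : ℕ → ℝ} {C : ℝ} (hu : ∀ i, |u i| ≤ C) :
    Summable fun i => t ^ i / (i.factorial : ℝ) * u i := by
  refine Summable.of_norm_bounded (g := fun i => |t| ^ i / (i.factorial : ℝ) * C)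
    ((Real.summable_pow_div_factorial |t|).mul_right C) fun i => ?_
  rw [Real.norm_eq_abs, abs_mul, abs_div, abs_pow, Nat.abs_cast]
  exact mul_le_mul_of_nonneg_left (hu i) (by positivity)

theorem hasSum_pow_div_factorial (t : ℝ) :
    HasSum (fun i : ℕ => t ^ i / (i.factorial : ℝ)) (Real.exp t) := by
  rw [Real.exp_eq_exp_ℝ]
  exact NormedSpace.expSeries_div_hasSum_exp t

/-- Borel summation is regular: Poisson averages with mean tending to infinity of a convergent
sequence converge to its limit. -/
theorem tendsto_poisson_average {u : ℕ → ℝ} {p : ℝ} (hp : Tendsto u atTop (𝓝 p)) :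
    Tendsto (fun t : ℝ => Real.exp (-t) * ∑' i, t ^ i / (i.factorial : ℝ) * u i) atTop (𝓝 p) := by
  obtain ⟨C, hC⟩ := (hp.sub_const p).abs.bddAbove_range
  have hC : ∀ i, |u i - p| ≤ C := fun i => hC ⟨i, rfl⟩
  have hu : ∀ i, |u i| ≤ C + |p| := fun i => by
    have h := abs_add_le (u i - p) p
    rw [sub_add_cancel] at h
    linarith [hC i]
  have hC0 : 0 ≤ C := (abs_nonneg _).trans (hC 0)
  rw [Metric.tendsto_atTop]
  intro ε hε
  obtain ⟨N, hN⟩ := Metric.tendsto_atTop.1 hp (ε / 2) (by positivity)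
  -- The first `N` terms, where only the bound `C` is known, have vanishing Poisson weight; the
  -- factorials are dropped. The remaining terms contribute at most `ε / 2`.
  have hlim : Tendsto (fun t : ℝ => ∑ i ∈ Finset.range N, C * (t ^ i * Real.exp (-t))) atTop
      (𝓝 0) := by
    have := tendsto_finsetSum (Finset.range N) fun i _ =>
      (Real.tendsto_pow_mul_exp_neg_atTop_nhds_zero i).const_mul C
    simpa using this
  obtain ⟨t₀, ht₀⟩ := eventually_atTop.1 ((hlim.eventually_lt_const (half_pos hε)).and
    (eventually_ge_atTop 0))
  refine ⟨t₀, fun t ht => ?_⟩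
  obtain ⟨h1, h0⟩ := ht₀ t ht
  have hsum := summable_pow_div_factorial_mul t hu
  have hexp := hasSum_pow_div_factorial t
  have e1 : Real.exp (-t) * Real.exp t = 1 := by rw [← Real.exp_add]; simp
  have e2 : Real.exp (-t) * (∑' i, t ^ i / (i.factorial : ℝ) * u i) - p
      = Real.exp (-t) * ∑' i, t ^ i / (i.factorial : ℝ) * (u i - p) := by
    simp_rw [mul_sub]
    rw [hsum.tsum_sub (hexp.summable.mul_right p), tsum_mul_right, hexp.tsum_eq, mul_sub,
      ← mul_assoc _ _ p, e1, one_mul]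
  rw [Real.dist_eq, e2, abs_mul, Real.abs_exp]
  have hs := summable_pow_div_factorial_mul t (u := fun i => |u i - p|) (by simpa using hC)
  have hfin : HasSum (fun i : ℕ => if i ∈ Finset.range N then t ^ i / (i.factorial : ℝ) * C else 0)
      (∑ i ∈ Finset.range N, t ^ i / (i.factorial : ℝ) * C) := by
    have := hasSum_sum_of_ne_finset_zero (L := .unconditional ℕ) (s := Finset.range N)
      (f := fun i : ℕ => if i ∈ Finset.range N then t ^ i / (i.factorial : ℝ) * C else 0)
      (fun b hb => if_neg hb)
    rwa [Finset.sum_congr rfl fun i hi => if_pos hi] at this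
  have h2 : |∑' i, t ^ i / (i.factorial : ℝ) * (u i - p)|
      ≤ ∑ i ∈ Finset.range N, t ^ i / (i.factorial : ℝ) * C + Real.exp t * (ε / 2) := by
    have h3 : |∑' i, t ^ i / (i.factorial : ℝ) * (u i - p)|
        ≤ ∑' i, t ^ i / (i.factorial : ℝ) * |u i - p| := by
      rw [← Real.norm_eq_abs]
      refine tsum_of_norm_bounded hs.hasSum fun i => ?_
      rw [Real.norm_eq_abs, abs_mul, abs_of_nonneg (by positivity)]
    refine h3.trans (hasSum_le (fun i => ?_) hs.hasSum (hfin.add (hexp.mul_right (ε / 2))))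
    split_ifs with hi
    · have : t ^ i / (i.factorial : ℝ) * |u i - p| ≤ t ^ i / (i.factorial : ℝ) * C :=
        mul_le_mul_of_nonneg_left (hC i) (by positivity)
      have : 0 ≤ t ^ i / (i.factorial : ℝ) * (ε / 2) := by positivity
      linarith
    · rw [zero_add]
      refine mul_le_mul_of_nonneg_left ?_ (by positivity)
      have := hN i (by simpa using hi)
      rw [Real.dist_eq] at this
      exact this.le
  have h4 : Real.exp (-t) * ∑ i ∈ Finset.range N, t ^ i / (i.factorial : ℝ) * C
      ≤ ∑ i ∈ Finset.range N, C * (t ^ i * Real.exp (-t)) := by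
    rw [Finset.mul_sum]
    refine Finset.sum_le_sum fun i _ => ?_
    have : t ^ i / (i.factorial : ℝ) ≤ t ^ i :=
      div_le_self (by positivity) (by exact_mod_cast Nat.one_le_iff_ne_zero.2 i.factorial_ne_zero)
    calc _ = C * (t ^ i / (i.factorial : ℝ) * Real.exp (-t)) := by ring
      _ ≤ _ := by gcongr
  calc _ ≤ Real.exp (-t) * (∑ i ∈ Finset.range N, t ^ i / (i.factorial : ℝ) * C
        + Real.exp t * (ε / 2)) := mul_le_mul_of_nonneg_left h2 (Real.exp_pos _).le
    _ = Real.exp (-t) * ∑ i ∈ Finset.range N, t ^ i / (i.factorial : ℝ) * C + ε / 2 := by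
      rw [mul_add, ← mul_assoc, e1, one_mul]
    _ < ε := by linarith

namespace XModel

variable {M : XModel} {x : FluidState}

/-! ### Uniformization and convergence in continuous time. -/

theorem iterate_genApply (f : ℤ → ℝ) (i : ℕ) : (M.genApply x)^[i] f = (M.genLin x ^ i) f :=
  (Module.End.pow_apply (M.genLin x) i f).symm

theorem genLin_eq (hx : M.InStateSpace x) :
    M.genLin x = (2 * M.totalRate x) • (M.lazyStep x + (-1 : ℝ) • 1) := by
  have := totalRate_pos hx
  have h : M.lazyStep x + (-1 : ℝ) • 1 = (2 * M.totalRate x)⁻¹ • M.genLin x := by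
    rw [lazyStep]; module
  rw [h, smul_smul, mul_inv_cancel₀ (by positivity), one_smul]

/-- `Q = 2T (P - 1)` and `P` does not increase the sup norm, whence the factor `4T`. This dominates
the exponential series. -/
theorem abs_genLin_pow_le (hx : M.InStateSpace x) {f : ℤ → ℝ} {C : ℝ} (hf : ∀ l, |f l| ≤ C)
    (i : ℕ) (l : ℤ) : |(M.genLin x ^ i) f l| ≤ (4 * M.totalRate x) ^ i * C := by
  have hT := totalRate_pos hx
  induction i generalizing l with
  | zero => simpa using hf l
  | succ i ih =>
    rw [pow_succ' (M.genLin x), Module.End.mul_apply]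
    set g := (M.genLin x ^ i) f
    have h1 := abs_lazyStep_le hx ih l
    have e : M.genLin x g l = 2 * M.totalRate x * (M.lazyStep x g l - g l) := by
      rw [lazyStep_apply, genLin_apply]; field_simp; ring
    rw [e, abs_mul, abs_of_pos (by positivity)]
    have := abs_sub (M.lazyStep x g l) (g l)
    calc _ ≤ 2 * M.totalRate x * ((4 * M.totalRate x) ^ i * C + (4 * M.totalRate x) ^ i * C) :=
          mul_le_mul_of_nonneg_left (this.trans (add_le_add h1 (ih l))) (by positivity)
      _ = _ := by ring

theorem abs_semigroup_term_le (hx : M.InStateSpace x) {f : ℤ → ℝ} {C : ℝ} (hf : ∀ l, |f l| ≤ C)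
    (s : ℝ) (i : ℕ) (l : ℤ) :
    ‖s ^ i / (i.factorial : ℝ) * ((M.genApply x)^[i] f) l‖
      ≤ (|s| * (4 * M.totalRate x)) ^ i / (i.factorial : ℝ) * C := by
  rw [iterate_genApply, Real.norm_eq_abs, abs_mul, abs_div, abs_pow, Nat.abs_cast]
  refine (mul_le_mul_of_nonneg_left (abs_genLin_pow_le hx hf i l) (by positivity)).trans_eq ?_
  rw [mul_pow]; ring

theorem summable_semigroup (hx : M.InStateSpace x) {f : ℤ → ℝ} {C : ℝ} (hf : ∀ l, |f l| ≤ C)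
    (s : ℝ) (l : ℤ) :
    Summable fun i : ℕ => s ^ i / (i.factorial : ℝ) * ((M.genApply x)^[i] f) l :=
  Summable.of_norm_bounded ((Real.summable_pow_div_factorial _).mul_right C)
    fun i => abs_semigroup_term_le hx hf s i l

/-- Uniformization: the semigroup is a Poisson average of powers of the lazy jump chain. -/
theorem semigroup_eq (hx : M.InStateSpace x) {f : ℤ → ℝ} {C : ℝ} (hf : ∀ l, |f l| ≤ C)
    (s : ℝ) (l : ℤ) :
    M.semigroup x s f l = Real.exp (-(2 * M.totalRate x * s)) *
      ∑' i : ℕ, (2 * M.totalRate x * s) ^ i / (i.factorial : ℝ) * (M.lazyStep x ^ i) f l := by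
  set t := 2 * M.totalRate x * s
  -- The identity is `e^{t(P - 1)} = e^{-t} e^{tP}`: the Cauchy product of the two series is matched
  -- with the binomial expansion of `(P - 1)ⁿ`.
  rw [mul_comm, ← (hasSum_pow_div_factorial (-t)).tsum_eq,
    tsum_mul_tsum_eq_tsum_sum_antidiagonal_of_summable_norm
      (summable_pow_div_factorial_mul t fun i => abs_lazyStep_pow_le hx hf i l).norm
      (Real.summable_pow_div_factorial (-t)).norm]
  refine tsum_congr fun n => ?_
  rw [iterate_genApply, genLin_eq hx, smul_pow, LinearMap.smul_apply,
    ((Commute.one_right (M.lazyStep x)).smul_right (-1 : ℝ)).add_pow', LinearMap.sum_apply,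
    Pi.smul_apply, Finset.sum_apply, smul_eq_mul, Finset.mul_sum, Finset.mul_sum]
  refine Finset.sum_congr rfl fun ⟨a, b⟩ hab => ?_
  have hab := Finset.HasAntidiagonal.mem_antidiagonal.1 hab
  dsimp only at hab ⊢
  subst hab
  rw [smul_pow, one_pow, Algebra.mul_smul_comm, mul_one, LinearMap.smul_apply, LinearMap.smul_apply,
    Pi.smul_apply, Pi.smul_apply, nsmul_eq_mul, smul_eq_mul,
    Nat.cast_choose ℝ (Nat.le_add_right a b), Nat.add_sub_cancel_left]
  have h1 : ((a + b).factorial : ℝ) ≠ 0 := by exact_mod_cast (a + b).factorial_ne_zero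
  have h2 : (a.factorial : ℝ) ≠ 0 := by exact_mod_cast a.factorial_ne_zero
  have h3 : (b.factorial : ℝ) ≠ 0 := by exact_mod_cast b.factorial_ne_zero
  have h4 : (-t) ^ b = (-1) ^ b * t ^ b := neg_pow t b
  rw [h4]
  field_simp
  simp only [t]
  ring

theorem abs_semigroup_le (hx : M.InStateSpace x) {f : ℤ → ℝ} {C : ℝ} (hf : ∀ l, |f l| ≤ C)
    {s : ℝ} (hs : 0 ≤ s) (l : ℤ) : |M.semigroup x s f l| ≤ C := by
  have hT := totalRate_pos hx
  rw [semigroup_eq hx hf, abs_mul, Real.abs_exp]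
  set t := 2 * M.totalRate x * s
  have ht : 0 ≤ t := by positivity
  have : ‖∑' i : ℕ, t ^ i / (i.factorial : ℝ) * (M.lazyStep x ^ i) f l‖ ≤ Real.exp t * C := by
    refine tsum_of_norm_bounded ((hasSum_pow_div_factorial t).mul_right C) fun i => ?_
    rw [Real.norm_eq_abs, abs_mul, abs_of_nonneg (by positivity)]
    exact mul_le_mul_of_nonneg_left (abs_lazyStep_pow_le hx hf i l) (by positivity)
  calc _ ≤ Real.exp (-t) * (Real.exp t * C) :=
        mul_le_mul_of_nonneg_left this (Real.exp_pos _).le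
    _ = C := by rw [← mul_assoc, ← Real.exp_add]; simp

theorem IsStationary.tendsto_semigroup (hx : M.InStateSpace x) {α f : ℤ → ℝ} {C : ℝ}
    (hα : M.IsStationary x α) (hf : ∀ l, |f l| ≤ C) (l : ℤ) :
    Tendsto (fun s => M.semigroup x s f l) atTop (𝓝 (∑' n, α n * f n)) := by
  have hT := totalRate_pos hx
  have h := (tendsto_poisson_average (hα.tendsto_lazyStep_pow hx hf l)).comp
    (tendsto_id.const_mul_atTop (show 0 < 2 * M.totalRate x by positivity))
  exact h.congr fun s => (semigroup_eq hx hf s l).symm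

theorem abs_indicator_one_le (A : Set ℤ) (l : ℤ) : |A.indicator (1 : ℤ → ℝ) l| ≤ 1 := by
  classical
  rw [Set.indicator_apply]; split_ifs <;> simp

/-- The transition probabilities are countably additive in the target set. -/
theorem hasSum_probIn (hx : M.InStateSpace x) (s : ℝ) (l : ℤ) (A : Set ℤ) :
    HasSum (A.indicator fun n => M.probIn x s l {n}) (M.probIn x s l A) := by
  have hF : ∀ (S : Finset ℤ) (m : ℤ), ((S : Set ℤ) ∩ A).indicator (1 : ℤ → ℝ) m
      = (∑ n ∈ S, A.indicator (fun n => ({n} : Set ℤ).indicator (1 : ℤ → ℝ)) n) m := by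
    intro S m
    rw [Finset.sum_apply]
    by_cases hm : m ∈ S
    · rw [Finset.sum_eq_single m]
      · by_cases hA : m ∈ A <;> simp [hm, hA]
      · intro b _ hb
        by_cases hA : b ∈ A <;> simp [hA, hb.symm]
      · exact fun h => absurd hm h
    · rw [Finset.sum_eq_zero]
      · simp [hm]
      · intro b hb
        have : m ≠ b := fun h => hm (h ▸ hb)
        by_cases hA : b ∈ A <;> simp [hA, this]
  have hadd : ∀ S : Finset ℤ, ∑ n ∈ S, A.indicator (fun n => M.probIn x s l {n}) n
      = M.semigroup x s (((S : Set ℤ) ∩ A).indicator 1) l := by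
    intro S
    rw [funext (hF S)]
    simp only [semigroup, iterate_genApply, map_sum, Finset.sum_apply, Finset.mul_sum]
    rw [Summable.tsum_finsetSum]
    · refine Finset.sum_congr rfl fun n _ => ?_
      by_cases hA : n ∈ A
      · simp only [Set.indicator_of_mem hA, probIn, semigroup, iterate_genApply]
      · simp [hA]
    · intro n _
      by_cases hA : n ∈ A
      · simp only [Set.indicator_of_mem hA, ← iterate_genApply]
        exact summable_semigroup hx (abs_indicator_one_le {n}) s l
      · simp [hA]
  rw [HasSum, SummationFilter.unconditional_filter]
  simp_rw [hadd]
  clear hadd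
  -- The partial sum over a finite set `S` is the semigroup applied to the indicator of `S ∩ A`. As
  -- `S` grows these indicators converge pointwise, every power of `Q` preserves this, and the
  -- series is dominated uniformly in `S`.
  refine tendsto_tsum_of_dominated_convergence
    ((Real.summable_pow_div_factorial (|s| * (4 * M.totalRate x))).mul_right 1) (fun i => ?_)
    (Eventually.of_forall fun S i => abs_semigroup_term_le hx (abs_indicator_one_le _) s i l)
  refine Tendsto.const_mul _ ?_
  induction i generalizing l with
  | zero =>
    classical
    refine tendsto_const_nhds.congr' ?_
    filter_upwards [eventually_ge_atTop {l}] with S hS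
    have : l ∈ S := hS (Finset.mem_singleton_self l)
    by_cases hA : l ∈ A <;> simp [this, hA]
  | succ i ih =>
    simp_rw [Function.iterate_succ_apply']
    exact tendsto_genApply ih l

theorem hasSum_measureReal_inter_preimage {Ω : Type*} [MeasurableSpace Ω] (P : Measure Ω)
    [IsProbabilityMeasure P] {X : Ω → ℤ} (hX : Measurable X) {E : Set Ω} (hE : MeasurableSet E) :
    HasSum (fun n => P.real (E ∩ X ⁻¹' {n})) (P.real E) := by
  have h : P E = ∑' n, P (E ∩ X ⁻¹' {n}) := by
    rw [← measure_iUnion]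
    · rw [← Set.inter_iUnion, ← Set.preimage_iUnion, Set.iUnion_of_singleton, Set.preimage_univ,
        Set.inter_univ]
    · intro a b hab
      refine Disjoint.mono Set.inter_subset_right Set.inter_subset_right ?_
      exact Disjoint.preimage _ (Set.disjoint_singleton.2 hab)
    · exact fun n => hE.inter (hX (measurableSet_singleton n))
  have hne : ∑' n, P (E ∩ X ⁻¹' {n}) ≠ ⊤ := h ▸ measure_ne_top P E
  have h2 := ENNReal.hasSum_toReal hne
  rwa [← ENNReal.tsum_toReal_eq fun n => measure_ne_top P _, ← h] at h2

/-- The one-dimensional marginals of a chain are mixtures of its transition probabilities. -/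
theorem IsFTSP.hasSum_marginal (hx : M.InStateSpace x) {Ω : Type*} [MeasurableSpace Ω]
    {P : Measure Ω} [IsProbabilityMeasure P] {D : ℝ≥0 → Ω → ℤ} (hD : M.IsFTSP x P D) (s : ℝ≥0)
    (A : Set ℤ) :
    HasSum (fun l => P.real (D 0 ⁻¹' {l}) * M.probIn x s l A) (P.real (D s ⁻¹' A)) := by
  refine (hasSum_measureReal_inter_preimage P (hD.measurable 0)
    (hD.measurable s (MeasurableSet.of_discrete (s := A)))).congr_terms fun l => ?_
  refine ((hasSum_probIn hx s l A).mul_left _).unique ?_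
  refine (hasSum_measureReal_inter_preimage P (hD.measurable s)
    ((hD.measurable s (MeasurableSet.of_discrete (s := A))).inter
      (hD.measurable 0 (measurableSet_singleton l)))).congr_terms fun n => ?_
  by_cases hn : n ∈ A
  -- The Markov property is needed only from time `0` and with the trivial past event.
  · have h := hD.markov 0 s Set.univ MeasurableSet.univ l n
    rw [Set.univ_inter, zero_add] at h
    rw [Set.indicator_of_mem hn, ← h]
    congr 1
    ext ω
    simp only [Set.mem_inter_iff, Set.mem_preimage, Set.mem_singleton_iff]
    constructor
    · rintro ⟨h1, h2⟩; exact ⟨⟨h2 ▸ hn, h1⟩, h2⟩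
    · rintro ⟨⟨_, h1⟩, h2⟩; exact ⟨h1, h2⟩
  · rw [Set.indicator_of_notMem hn, mul_zero]
    convert (measureReal_empty (μ := P)).symm
    ext ω
    simp only [Set.mem_inter_iff, Set.mem_preimage, Set.mem_singleton_iff, Set.mem_empty_iff_false,
      iff_false]
    rintro ⟨⟨h1, -⟩, h2⟩
    exact hn (h2 ▸ h1)

/-- The limit from each fixed state passes to an arbitrary initial law by dominated convergence over
the law of `D 0`. -/
theorem IsStationary.isPi (hx : M.InStateSpace x) {α : ℤ → ℝ} (hα : M.IsStationary x α) :
    IsPi.{u} M x (∑' n, (Set.Ioi 0).indicator α n) := by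
  have e : ∑' n, (Set.Ioi 0).indicator α n = ∑' n, α n * (Set.Ioi 0).indicator (1 : ℤ → ℝ) n := by
    refine tsum_congr fun n => ?_
    by_cases hn : n ∈ Set.Ioi (0 : ℤ) <;> simp [Set.indicator_apply]
  have h1 : ∀ l : ℤ, Tendsto (fun s : ℝ => M.probIn x s l (Set.Ioi 0)) atTop
      (𝓝 (∑' n, (Set.Ioi 0).indicator α n)) := fun l => by
    rw [e]
    exact hα.tendsto_semigroup hx (abs_indicator_one_le _) l
  refine ⟨h1, ?_⟩
  intro Ω _ P _ D hD
  have hs := hasSum_measureReal_inter_preimage P (hD.measurable 0) MeasurableSet.univ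
  simp only [Set.univ_inter, probReal_univ] at hs
  have h2 := tendsto_tsum_mul (𝓕 := atTop) (F := fun (s : ℝ≥0) l => M.probIn x s l (Set.Ioi 0))
    hs.summable (fun s l => abs_semigroup_le hx (abs_indicator_one_le _) s.2 l)
    (fun l => (h1 l).comp (NNReal.tendsto_coe_atTop.2 tendsto_id))
  rw [tsum_mul_right, hs.tsum_eq, one_mul] at h2
  exact h2.congr fun s => (hD.hasSum_marginal hx s (Set.Ioi 0)).tsum_eq

/-! ### The drift identity and the formula of part (a). -/

theorem genApply_coe (l : ℤ) :
    M.genApply x (fun n => (n : ℝ)) l = if 0 < l then M.driftPos x else M.driftNeg x := by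
  unfold genApply upK upJ downK downJ driftPos driftNeg
  push_cast
  split_ifs <;> ring

theorem abs_clamp_sub_le (N a b : ℝ) : |max (-N) (min N a) - max (-N) (min N b)| ≤ |a - b| := by
  refine (abs_max_sub_max_le_max _ _ _ _).trans ?_
  rw [sub_self, abs_zero, max_eq_right (abs_nonneg _)]
  refine (abs_min_sub_min_le_max _ _ _ _).trans ?_
  rw [sub_self, abs_zero, max_eq_right (abs_nonneg _)]

/-- The mean drift vanishes in equilibrium. -/
theorem IsStationary.tsum_mul_drift (hx : M.InStateSpace x) {α : ℤ → ℝ}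
    (hα : M.IsStationary x α) :
    ∑' l : ℤ, α l * (if 0 < l then M.driftPos x else M.driftNeg x) = 0 := by
  -- The identity function is unbounded and `α` is not known to have a first moment, so the identity
  -- is truncated at `±N`. Truncation is 1-Lipschitz and jumps are bounded, so `Q (F N)` is bounded
  -- uniformly in `N`.
  set F : ℕ → ℤ → ℝ := fun N n => max (-(N : ℝ)) (min N n) with hF
  have hFb : ∀ N l, |F N l| ≤ N := fun N l =>
    abs_le.2 ⟨le_max_left _ _, max_le (by linarith [N.cast_nonneg (α := ℝ)]) (min_le_left _ _)⟩
  have hlim : ∀ l : ℤ, Tendsto (fun N => F N l) atTop (𝓝 (l : ℝ)) := by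
    intro l
    refine tendsto_const_nhds.congr' ?_
    filter_upwards [eventually_ge_atTop l.natAbs] with N hN
    have h1 : |(l : ℝ)| ≤ N := by
      rw [← Int.cast_abs, Int.abs_eq_natAbs]; exact_mod_cast hN
    have := abs_le.1 h1
    rw [hF]
    dsimp only
    rw [min_eq_right this.2, max_eq_right this.1]
  have hdiff : ∀ N (l d : ℤ), |F N d - F N l| ≤ |(d : ℝ) - l| := fun N l d =>
    abs_clamp_sub_le _ _ _
  have hT := totalRate_pos hx
  have key : ∀ (N : ℕ) (l d : ℤ) (c : ℝ), 0 ≤ c → c ≤ M.totalRate x → |(d : ℝ) - l| ≤ M.k + M.j →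
      |c * (F N d - F N l)| ≤ M.totalRate x * (M.k + M.j) := by
    intro N l d c h0 h1 h2
    rw [abs_mul, abs_of_nonneg h0]
    exact mul_le_mul h1 ((hdiff N l d).trans h2) (abs_nonneg _) hT.le
  have hk : (0 : ℝ) ≤ M.k := Nat.cast_nonneg _
  have hj : (0 : ℝ) ≤ M.j := Nat.cast_nonneg _
  have hbound : ∀ N l, |M.genApply x (F N) l| ≤ M.totalRate x * (M.k + M.j)
      + M.totalRate x * (M.k + M.j) + M.totalRate x * (M.k + M.j)
      + M.totalRate x * (M.k + M.j) := by
    intro N l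
    refine (abs_add_le _ _).trans (add_le_add ((abs_add_le _ _).trans (add_le_add
          ((abs_add_le _ _).trans (add_le_add ?_ ?_)) ?_)) ?_)
    · refine key N l _ _ (upK_pos l).le (upK_le hx l) ?_
      push_cast; rw [abs_le]; constructor <;> linarith
    · refine key N l _ _ (upJ_nonneg hx l) (upJ_le hx l) ?_
      push_cast; rw [abs_le]; constructor <;> linarith
    · refine key N l _ _ (downK_pos hx l).le (downK_le hx l) ?_
      push_cast; rw [abs_le]; constructor <;> linarith
    · refine key N l _ _ (downJ_pos l).le (downJ_le hx l) ?_
      push_cast; rw [abs_le]; constructor <;> linarith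
  have h := tendsto_tsum_mul hα.summable hbound fun l => tendsto_genApply (x := x) hlim l
  simp_rw [(hα.tsum_mul_genApply hx (hFb _)).2, genApply_coe] at h
  exact (tendsto_nhds_unique tendsto_const_nhds h).symm

/-- The drift takes one value on each side of the origin, so its zero mean is a linear equation for
the mass of the positive side. -/
theorem IsStationary.tsum_indicator_eq (hx : M.InStateSpace x) {α : ℤ → ℝ}
    (hα : M.IsStationary x α) (hpos : M.driftPos x < 0) (hneg : 0 < M.driftNeg x) :
    ∑' n, (Set.Ioi 0).indicator α n = M.driftNeg x / (M.driftNeg x - M.driftPos x) := by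
  have h := hα.tsum_mul_drift hx
  have e : ∀ l : ℤ, α l * (if 0 < l then M.driftPos x else M.driftNeg x)
      = (Set.Ioi 0).indicator α l * (M.driftPos x - M.driftNeg x) + α l * M.driftNeg x := by
    intro l
    simp only [Set.indicator_apply, Set.mem_Ioi]
    split_ifs <;> ring
  simp_rw [e] at h
  rw [((hα.summable.indicator _).mul_right _).tsum_add (hα.summable.mul_right _), tsum_mul_right,
    tsum_mul_right, hα.hasSum_one.tsum_eq] at h
  rw [eq_div_iff (by linarith)]
  linarith

end XModel

/-! ### The least solution of the matrix equation, and geometric series of matrices. -/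

namespace Matrix

variable {ι : Type*} [Fintype ι]

theorem mul_apply_nonneg {A B : Matrix ι ι ℝ} (hA : ∀ a b, 0 ≤ A a b) (hB : ∀ a b, 0 ≤ B a b)
    (a b : ι) : 0 ≤ (A * B) a b :=
  Finset.sum_nonneg fun c _ => mul_nonneg (hA a c) (hB c b)

theorem mul_apply_mono {A A' B B' : Matrix ι ι ℝ} (hA : ∀ a b, A a b ≤ A' a b)
    (hB : ∀ a b, B a b ≤ B' a b) (hA' : ∀ a b, 0 ≤ A' a b) (hB0 : ∀ a b, 0 ≤ B a b) (a b : ι) :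
    (A * B) a b ≤ (A' * B') a b :=
  Finset.sum_le_sum fun c _ => mul_le_mul (hA a c) (hB c b) (hB0 c b) (hA' a c)

theorem vecMul_mono {v w : ι → ℝ} {A : Matrix ι ι ℝ} (hv : ∀ b, v b ≤ w b)
    (hA : ∀ a b, 0 ≤ A a b) (b : ι) : (v ᵥ* A) b ≤ (w ᵥ* A) b :=
  Finset.sum_le_sum fun c _ => mul_le_mul_of_nonneg_right (hv c) (hA c b)

theorem mul_block {σ : ι → Prop} {A B : Matrix ι ι ℝ} (hA : ∀ a b, ¬(σ a ↔ σ b) → A a b = 0)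
    (hB : ∀ a b, ¬(σ a ↔ σ b) → B a b = 0) (a b : ι) (h : ¬(σ a ↔ σ b)) : (A * B) a b = 0 := by
  refine Finset.sum_eq_zero fun c _ => ?_
  change A a c * B c b = 0
  by_cases hac : σ a ↔ σ c
  · rw [hB c b (fun hcb => h (hac.trans hcb)), mul_zero]
  · rw [hA a c hac, zero_mul]

variable [DecidableEq ι]

/-- The matrix equation `A₀ + R A₁ + R² A₂ = 0` of a quasi-birth-and-death process has a least
nonnegative solution as soon as the geometric row vectors `ηⁿ β` are superinvariant. -/
theorem exists_least_solution {A₀ A₁ A₂ : Matrix ι ι ℝ} {T η : ℝ} {β : ι → ℝ} (hT : 0 < T)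
    (h0 : ∀ a b, 0 ≤ A₀ a b) (h1 : ∀ a b, 0 ≤ (A₁ + T • 1) a b) (h2 : ∀ a b, 0 ≤ A₂ a b)
    (hη : 0 ≤ η) (hβ : ∀ b, 0 < β b)
    (hsup : ∀ b, (β ᵥ* A₀ + (η • β) ᵥ* A₁ + (η ^ 2 • β) ᵥ* A₂) b ≤ 0) :
    ∃ R : Matrix ι ι ℝ, (∀ a b, 0 ≤ R a b) ∧ A₀ + R * A₁ + R ^ 2 * A₂ = 0 ∧
      (∀ R' : Matrix ι ι ℝ, (∀ a b, 0 ≤ R' a b) → A₀ + R' * A₁ + R' ^ 2 * A₂ = 0 →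
        ∀ a b, R a b ≤ R' a b) ∧
      (∀ b, (β ᵥ* R) b ≤ η * β b) ∧
      ∀ σ : ι → Prop, (∀ a b, ¬(σ a ↔ σ b) → A₀ a b = 0 ∧ A₁ a b = 0 ∧ A₂ a b = 0) →
        ∀ a b, ¬(σ a ↔ σ b) → R a b = 0 := by
  set B : Matrix ι ι ℝ := A₁ + T • 1 with hB
  -- Adding `T R` to both sides turns the equation into a fixed-point problem for a map that is
  -- monotone on nonnegative matrices. Its iterates from `0` increase to the least fixed point once
  -- they are bounded.
  set G : Matrix ι ι ℝ → Matrix ι ι ℝ := fun R => T⁻¹ • (A₀ + R * B + R * R * A₂) with hG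
  have hTi : 0 < T⁻¹ := inv_pos.2 hT
  have hfix : ∀ R, G R = R ↔ A₀ + R * A₁ + R ^ 2 * A₂ = 0 := by
    intro R
    have e : A₀ + R * B + R * R * A₂ = (A₀ + R * A₁ + R ^ 2 * A₂) + T • R := by
      rw [hB, mul_add, Matrix.mul_smul, mul_one, sq]; abel
    rw [hG]
    dsimp only
    rw [e, smul_add, smul_smul, inv_mul_cancel₀ hT.ne', one_smul, add_eq_right,
      smul_eq_zero_iff_right hTi.ne']
  have hGmono : ∀ R R', (∀ a b, 0 ≤ R a b) → (∀ a b, R a b ≤ R' a b) →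
      ∀ a b, G R a b ≤ G R' a b := by
    intro R R' hR hRR' a b
    have hR' : ∀ a b, 0 ≤ R' a b := fun a b => (hR a b).trans (hRR' a b)
    refine mul_le_mul_of_nonneg_left ?_ hTi.le
    exact add_le_add (add_le_add le_rfl (mul_apply_mono hRR' (fun _ _ => le_rfl) hR' h1 a b))
      (mul_apply_mono (mul_apply_mono hRR' hRR' hR' hR) (fun _ _ => le_rfl)
        (mul_apply_nonneg hR' hR') h2 a b)
  have hGnn : ∀ R, (∀ a b, 0 ≤ R a b) → ∀ a b, 0 ≤ G R a b := by
    intro R hR a b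
    refine mul_nonneg hTi.le ?_
    exact add_nonneg (add_nonneg (h0 a b) (mul_apply_nonneg hR h1 a b))
      (mul_apply_nonneg (mul_apply_nonneg hR hR) h2 a b)
  set S : ℕ → Matrix ι ι ℝ := fun t => G^[t] 0 with hS
  have hSs : ∀ t, S (t + 1) = G (S t) := fun t => Function.iterate_succ_apply' G t 0
  have hSnn : ∀ t a b, 0 ≤ S t a b := by
    intro t
    induction t with
    | zero => intro a b; exact le_rfl
    | succ t ih => rw [hSs]; exact hGnn _ ih
  have hSmono : ∀ t a b, S t a b ≤ S (t + 1) a b := by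
    intro t
    induction t with
    | zero => exact hSnn 1
    | succ t ih => rw [hSs, hSs (t + 1)]; exact hGmono _ _ (hSnn t) ih
  -- Superinvariance is exactly what makes this bound survive one application of `G`; as `β > 0`, it
  -- bounds every entry.
  have hSβ : ∀ t b, (β ᵥ* S t) b ≤ η * β b := by
    intro t
    induction t with
    | zero =>
      intro b
      change (β ᵥ* (0 : Matrix ι ι ℝ)) b ≤ _
      rw [vecMul_zero]
      exact mul_nonneg hη (hβ b).le
    | succ t ih =>
      intro b
      rw [hSs, hG]
      dsimp only
      rw [vecMul_smul, vecMul_add, vecMul_add, ← vecMul_vecMul, ← vecMul_vecMul, ← vecMul_vecMul]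
      have e1 := vecMul_mono (w := η • β) ih h1 b
      have e2 : ((β ᵥ* S t ᵥ* S t) ᵥ* A₂) b ≤ ((η ^ 2 • β) ᵥ* A₂) b := by
        refine vecMul_mono (fun c => ?_) h2 b
        refine (vecMul_mono (w := η • β) ih (hSnn t) c).trans ?_
        rw [smul_vecMul, Pi.smul_apply, Pi.smul_apply, smul_eq_mul, smul_eq_mul, sq, mul_assoc]
        exact mul_le_mul_of_nonneg_left (ih c) hη
      have e3 : ((η • β) ᵥ* B) b = ((η • β) ᵥ* A₁) b + T * (η * β b) := by
        rw [hB, vecMul_add, vecMul_smul, vecMul_one]; rfl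
      have e4 := hsup b
      simp only [Pi.add_apply, Pi.smul_apply, smul_eq_mul] at e4 ⊢
      calc _ ≤ T⁻¹ * (T * (η * β b)) := mul_le_mul_of_nonneg_left (by linarith) hTi.le
        _ = η * β b := inv_mul_cancel_left₀ hT.ne' _
  have hSbdd : ∀ t a b, S t a b ≤ η * β b / β a := by
    intro t a b
    rw [le_div_iff₀ (hβ a), mul_comm]
    refine le_trans ?_ (hSβ t b)
    exact Finset.single_le_sum (f := fun c => β c * S t c b)
      (fun c _ => mul_nonneg (hβ c).le (hSnn t c b)) (Finset.mem_univ a)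
  set R : Matrix ι ι ℝ := Matrix.of fun a b => ⨆ t, S t a b
  have hlim' : ∀ a b, Tendsto (fun t => S t a b) atTop (𝓝 (R a b)) := fun a b =>
    tendsto_atTop_ciSup (monotone_nat_of_le_succ fun t => hSmono t a b)
      ⟨η * β b / β a, by rintro _ ⟨t, rfl⟩; exact hSbdd t a b⟩
  have hlim : Tendsto S atTop (𝓝 R) :=
    tendsto_pi_nhds.2 fun a => tendsto_pi_nhds.2 fun b => hlim' a b
  have hGc : Continuous G := by rw [hG]; fun_prop
  refine ⟨R, fun a b => ge_of_tendsto' (hlim' a b) fun t => hSnn t a b, ?_, ?_, ?_, ?_⟩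
  · rw [← hfix]
    refine tendsto_nhds_unique ((hGc.tendsto R).comp hlim) ?_
    exact (hlim.comp (tendsto_add_atTop_nat 1)).congr fun t => hSs t
  · intro R' hR' hR'eq a b
    have hle : ∀ t a b, S t a b ≤ R' a b := by
      intro t
      induction t with
      | zero => exact hR'
      | succ t ih =>
        rw [hSs, ← (hfix R').2 hR'eq]
        exact hGmono _ _ (hSnn t) ih
    exact le_of_tendsto' (hlim' a b) fun t => hle t a b
  · intro b
    have hc : Continuous fun R : Matrix ι ι ℝ => (β ᵥ* R) b := by fun_prop
    exact le_of_tendsto' ((hc.tendsto R).comp hlim) fun t => hSβ t b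
  · intro σ hσ a b hab
    have hz : ∀ t a b, ¬(σ a ↔ σ b) → S t a b = 0 := by
      intro t
      induction t with
      | zero => intro a b _; rfl
      | succ t ih =>
        intro a b h
        have hBσ : ∀ a b, ¬(σ a ↔ σ b) → B a b = 0 := by
          intro a b h
          have hne : a ≠ b := fun e => h (e ▸ Iff.rfl)
          simp [hB, (hσ a b h).2.1, hne]
        rw [hSs]
        change T⁻¹ * (A₀ a b + (S t * B) a b + (S t * S t * A₂) a b) = 0
        rw [(hσ a b h).1, mul_block ih hBσ a b h,
          mul_block (mul_block ih ih) (fun a b h => (hσ a b h).2.2) a b h]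
        simp
    exact tendsto_nhds_unique (hlim' a b) (by simp_rw [hz _ a b hab]; exact tendsto_const_nhds)

variable {S : Matrix ι ι ℝ} {β : ι → ℝ} {η : ℝ}

/-- Right multiplication by `S` contracts the weighted norm `max |v b| / β b` by the factor `η`. -/
theorem abs_vecMul_pow_le (hS : ∀ a b, 0 ≤ S a b) (hβ : ∀ b, 0 < β b) (hη : 0 ≤ η)
    (h : ∀ b, (β ᵥ* S) b ≤ η * β b) (a : ι → ℝ) :
    ∃ K, 0 ≤ K ∧ ∀ n b, |(a ᵥ* S ^ n) b| ≤ η ^ n * (K * β b) := by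
  refine ⟨∑ c, |a c| / β c, Finset.sum_nonneg fun c _ => div_nonneg (abs_nonneg _) (hβ c).le,
    fun n => ?_⟩
  induction n with
  | zero =>
    intro b
    rw [pow_zero, pow_zero, vecMul_one, one_mul, ← div_le_iff₀ (hβ b)]
    exact Finset.single_le_sum (f := fun c => |a c| / β c)
      (fun c _ => div_nonneg (abs_nonneg _) (hβ c).le) (Finset.mem_univ b)
  | succ n ih =>
    intro b
    set K := ∑ c, |a c| / β c
    have hK : 0 ≤ K := Finset.sum_nonneg fun c _ => div_nonneg (abs_nonneg _) (hβ c).le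
    rw [pow_succ, ← vecMul_vecMul]
    calc _ ≤ ∑ c, |(a ᵥ* S ^ n) c * S c b| := Finset.abs_sum_le_sum_abs _ _
      _ ≤ ∑ c, η ^ n * (K * β c) * S c b := Finset.sum_le_sum fun c _ => by
          rw [abs_mul, abs_of_nonneg (hS c b)]
          exact mul_le_mul_of_nonneg_right (ih c) (hS c b)
      _ = η ^ n * K * (β ᵥ* S) b := by
          rw [vecMul, dotProduct, Finset.mul_sum]
          exact Finset.sum_congr rfl fun c _ => by ring
      _ ≤ η ^ n * K * (η * β b) := mul_le_mul_of_nonneg_left (h b) (by positivity)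
      _ = _ := by ring

theorem summable_vecMul_pow (hS : ∀ a b, 0 ≤ S a b) (hβ : ∀ b, 0 < β b) (hη : 0 ≤ η) (hη1 : η < 1)
    (h : ∀ b, (β ᵥ* S) b ≤ η * β b) (a : ι → ℝ) :
    Summable fun p : ℕ × ι => (a ᵥ* S ^ p.1) p.2 := by
  obtain ⟨K, hK, hb⟩ := abs_vecMul_pow_le hS hβ hη h a
  refine Summable.of_norm_bounded (g := fun p : ℕ × ι => η ^ p.1 * (K * β p.2)) ?_
    fun p => hb p.1 p.2
  exact (summable_geometric_of_lt_one hη hη1).mul_of_nonneg (Summable.of_finite)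
    (fun n => pow_nonneg hη n) fun b => mul_nonneg hK (hβ b).le

/-- A row vector fixed by `S` is fixed by all `Sⁿ`, which tend to zero on it. -/
theorem isUnit_one_sub (hS : ∀ a b, 0 ≤ S a b) (hβ : ∀ b, 0 < β b) (hη : 0 ≤ η) (hη1 : η < 1)
    (h : ∀ b, (β ᵥ* S) b ≤ η * β b) : IsUnit (1 - S) := by
  rw [← vecMul_injective_iff_isUnit]
  intro v w hvw
  dsimp only at hvw
  rw [← sub_eq_zero, ← sub_vecMul, vecMul_sub, vecMul_one, sub_eq_zero] at hvw
  have hpow : ∀ n, (v - w) ᵥ* S ^ n = v - w := by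
    intro n
    induction n with
    | zero => simp
    | succ n ih => rw [pow_succ, ← vecMul_vecMul, ih, ← hvw]
  obtain ⟨K, -, hb⟩ := abs_vecMul_pow_le hS hβ hη h (v - w)
  refine sub_eq_zero.1 (funext fun b => ?_)
  have hlim : Tendsto (fun n : ℕ => η ^ n * (K * β b)) atTop (𝓝 0) := by
    simpa using (tendsto_pow_atTop_nhds_zero_of_lt_one hη hη1).mul_const (K * β b)
  refine abs_eq_zero.1 (le_antisymm (ge_of_tendsto' hlim fun n => ?_) (abs_nonneg _))
  simpa only [hpow] using hb n b

/-- Neumann series: `w = ∑ a Sⁿ` telescopes to `w (1 - S) = a`. -/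
theorem hasSum_blockMass (hS : ∀ a b, 0 ≤ S a b) (hβ : ∀ b, 0 < β b) (hη : 0 ≤ η) (hη1 : η < 1)
    (h : ∀ b, (β ᵥ* S) b ≤ η * β b) (a : ι → ℝ) :
    HasSum (fun p : ℕ × ι => (a ᵥ* S ^ p.1) p.2) (blockMass a S) := by
  have hs := summable_vecMul_pow hS hβ hη hη1 h a
  have hu := isUnit_one_sub hS hβ hη hη1 h
  have hb : ∀ b, Summable fun n : ℕ => (a ᵥ* S ^ n) b := fun b =>
    (hs.comp_injective (i := fun n : ℕ => (n, b)) fun n m e => (Prod.ext_iff.1 e).1 :)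
  set w : ι → ℝ := fun b => ∑' n, (a ᵥ* S ^ n) b with hw
  have hw1 : w ᵥ* (1 - S) = a := by
    rw [vecMul_sub, vecMul_one]
    ext b
    have e : (w ᵥ* S) b = ∑' n, (a ᵥ* S ^ (n + 1)) b := by
      simp_rw [pow_succ, ← vecMul_vecMul]
      rw [vecMul, dotProduct]
      simp_rw [hw, ← tsum_mul_right]
      rw [← Summable.tsum_finsetSum fun c _ => (hb c).mul_right _]
      rfl
    rw [Pi.sub_apply, e, hw]
    dsimp only
    rw [(hb b).tsum_eq_zero_add, pow_zero, vecMul_one, add_sub_cancel_right]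
  have hw2 : a ᵥ* (1 - S)⁻¹ = w := by
    rw [← hw1, vecMul_vecMul, mul_nonsing_inv _ ((isUnit_iff_isUnit_det _).1 hu), vecMul_one]
  rw [blockMass, hw2, dotProduct_one]
  have h1 := hs.hasSum
  rwa [hs.tsum_prod, Summable.tsum_comm, tsum_fintype] at h1
  exact hs.prod_symm

end Matrix

namespace XModel

variable {M : XModel} {x : FluidState}

/-! ### Levels and the block tridiagonal form of the generator. -/

theorem blk_pos : 0 < M.blk := lt_max_of_lt_left M.j_pos

theorem j_le_blk : M.j ≤ M.blk := le_max_left _ _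

theorem k_le_blk : M.k ≤ M.blk := le_max_right _ _

theorem level_inl (n : ℕ) (i : Fin M.blk) :
    M.level n (Sum.inl i) = ((n * M.blk + i : ℕ) : ℤ) + 1 := by simp [level]

theorem level_inr (n : ℕ) (i : Fin M.blk) :
    M.level n (Sum.inr i) = -((n * M.blk + i : ℕ) : ℤ) := by simp [level]; ring

theorem mul_blk_add_injective {n n' : ℕ} {i i' : Fin M.blk}
    (h : n * M.blk + i = n' * M.blk + i') : n = n' ∧ i = i' := by
  have h1 : ∀ (n : ℕ) (i : Fin M.blk), (n * M.blk + i) / M.blk = n := fun n i => by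
    rw [mul_comm, Nat.mul_add_div blk_pos, Nat.div_eq_of_lt i.2, add_zero]
  have hn : n = n' := by rw [← h1 n i, h, h1]
  subst hn
  exact ⟨rfl, Fin.ext (by omega)⟩

theorem exists_mul_blk_add (N : ℕ) : ∃ (n : ℕ) (i : Fin M.blk), n * M.blk + i = N :=
  ⟨N / M.blk, ⟨N % M.blk, Nat.mod_lt _ blk_pos⟩, Nat.div_add_mod' N M.blk⟩

theorem exists_level_inl {z : ℤ} (hz : 0 < z) : ∃ n i, M.level n (Sum.inl i) = z := by
  obtain ⟨n, i, h⟩ := exists_mul_blk_add (M := M) (z - 1).toNat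
  exact ⟨n, i, by rw [level_inl, h]; omega⟩

theorem exists_level_inr {z : ℤ} (hz : z ≤ 0) : ∃ n i, M.level n (Sum.inr i) = z := by
  obtain ⟨n, i, h⟩ := exists_mul_blk_add (M := M) (-z).toNat
  exact ⟨n, i, by rw [level_inr, h]; omega⟩

theorem level_inl_pos (n : ℕ) (i : Fin M.blk) : 0 < M.level n (Sum.inl i) := by
  rw [level_inl]; omega

theorem level_inr_nonpos (n : ℕ) (i : Fin M.blk) : M.level n (Sum.inr i) ≤ 0 := by
  rw [level_inr]; omega

variable (M) in
/-- The levels partition the state space. -/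
theorem level_bijective : Function.Bijective fun p : ℕ × M.Phase => M.level p.1 p.2 := by
  constructor
  · rintro ⟨n, i | i⟩ ⟨n', i' | i'⟩ h <;> dsimp only at h
    · rw [level_inl, level_inl] at h
      obtain ⟨rfl, rfl⟩ := mul_blk_add_injective (by exact_mod_cast add_right_cancel h)
      rfl
    · exact absurd (h ▸ level_inl_pos n i) (level_inr_nonpos n' i').not_gt
    · exact absurd (h.symm ▸ level_inl_pos n' i') (level_inr_nonpos n i).not_gt
    · rw [level_inr, level_inr] at h
      obtain ⟨rfl, rfl⟩ := mul_blk_add_injective (by exact_mod_cast neg_injective h)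
      rfl
  · intro z
    rcases lt_or_ge 0 z with hz | hz
    · obtain ⟨n, i, h⟩ := exists_level_inl (M := M) hz
      exact ⟨(n, Sum.inl i), h⟩
    · obtain ⟨n, i, h⟩ := exists_level_inr (M := M) hz
      exact ⟨(n, Sum.inr i), h⟩

variable (M) in
/-- The bijection between pairs of a level and a phase, and states. -/
noncomputable def levelEquiv : ℕ × M.Phase ≃ ℤ := Equiv.ofBijective _ M.level_bijective

theorem levelEquiv_symm_level (n : ℕ) (b : M.Phase) : M.levelEquiv.symm (M.level n b) = (n, b) :=
  M.levelEquiv.symm_apply_eq.2 rfl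

theorem level_ne {n n' : ℕ} (h : n ≠ n') (a b : M.Phase) : M.level n a ≠ M.level n' b := fun e =>
  h (Prod.ext_iff.1 (M.level_bijective.1 (a₁ := (n, a)) (a₂ := (n', b)) e)).1

/-- Rates depend only on the side of the starting state, which makes the blocks independent of the
level. -/
theorem gen_congr {l n l' n' : ℤ} (h : 0 < l ↔ 0 < l') (h' : l - n = l' - n') :
    M.gen x l n = M.gen x l' n' := by
  have e1 : (l = n - M.k) ↔ (l' = n' - M.k) := by omega
  have e2 : (l = n - M.j) ↔ (l' = n' - M.j) := by omega
  have e3 : (l = n + M.k) ↔ (l' = n' + M.k) := by omega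
  have e4 : (l = n + M.j) ↔ (l' = n' + M.j) := by omega
  have e5 : (l = n) ↔ (l' = n') := by omega
  simp only [gen_eq, e1, e2, e3, e4, e5, upK, upJ, downK, downJ, h]

theorem gen_eq_zero {l n : ℤ} (h : l + M.blk < n ∨ n + M.blk < l) : M.gen x l n = 0 := by
  have := j_le_blk (M := M)
  have := k_le_blk (M := M)
  rw [gen_eq, if_neg (by omega), if_neg (by omega), if_neg (by omega), if_neg (by omega),
    if_neg (by omega)]
  simp

theorem gen_level_up (n : ℕ) (a b : M.Phase) :
    M.gen x (M.level n a) (M.level (n + 1) b) = M.blockA0 x a b := by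
  change _ = M.gen x (M.level 0 a) (M.level 1 b)
  rcases a with i | i <;> rcases b with i' | i' <;>
    simp only [level_inl, level_inr, add_mul, one_mul, zero_mul, zero_add]
  · exact gen_congr (by omega) (by omega)
  · rw [gen_eq_zero (by omega), gen_eq_zero (by omega)]
  · rw [gen_eq_zero (by omega), gen_eq_zero (by omega)]
  · exact gen_congr (by omega) (by omega)

theorem gen_level_same (n : ℕ) (a b : M.Phase) :
    M.gen x (M.level (n + 1) a) (M.level (n + 1) b) = M.blockA1 x a b := by
  change _ = M.gen x (M.level 1 a) (M.level 1 b)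
  have := blk_pos (M := M)
  rcases a with i | i <;> rcases b with i' | i' <;>
    simp only [level_inl, level_inr, add_mul, one_mul]
  · exact gen_congr (by omega) (by omega)
  · rw [gen_eq_zero (by omega), gen_eq_zero (by omega)]
  · rw [gen_eq_zero (by omega), gen_eq_zero (by omega)]
  · exact gen_congr (by omega) (by omega)

theorem gen_level_down (n : ℕ) (a b : M.Phase) :
    M.gen x (M.level (n + 1) a) (M.level n b) = M.blockA2 x a b := by
  change _ = M.gen x (M.level 1 a) (M.level 0 b)
  have := blk_pos (M := M)
  rcases a with i | i <;> rcases b with i' | i' <;>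
    simp only [level_inl, level_inr, add_mul, one_mul, zero_mul, zero_add]
  · exact gen_congr (by omega) (by omega)
  · rw [gen_eq_zero (by omega), gen_eq_zero (by omega)]
  · rw [gen_eq_zero (by omega), gen_eq_zero (by omega)]
  · exact gen_congr (by omega) (by omega)

theorem gen_level_far {n n' : ℕ} (h : n + 2 ≤ n' ∨ n' + 2 ≤ n) (a b : M.Phase) :
    M.gen x (M.level n a) (M.level n' b) = 0 := by
  have hb := blk_pos (M := M)
  apply gen_eq_zero
  rcases h with h | h <;> obtain ⟨d, rfl⟩ := Nat.exists_eq_add_of_le h <;>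
  rcases a with ⟨i, hi⟩ | ⟨i, hi⟩ <;> rcases b with ⟨i', hi'⟩ | ⟨i', hi'⟩ <;>
    simp only [level_inl, level_inr, add_mul] <;> omega

/-- States on opposite sides of the origin, at least one of them outside level `0`, are more than
`m` apart, beyond the reach of a jump. Only `B` mixes the sides. -/
theorem block_cross {a b : M.Phase} (h : ¬(a.isLeft = true ↔ b.isLeft = true)) :
    M.blockA0 x a b = 0 ∧ M.blockA1 x a b = 0 ∧ M.blockA2 x a b = 0 := by
  have hb := blk_pos (M := M)
  rcases a with i | i <;> rcases b with i' | i' <;> simp at h <;>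
  refine ⟨?_, ?_, ?_⟩ <;>
  · simp only [blockA0, blockA1, blockA2, Matrix.of_apply, level_inl, level_inr]
    exact gen_eq_zero (by omega)

theorem gen_add_nonneg (hx : M.InStateSpace x) (l n : ℤ) :
    0 ≤ M.gen x l n + if l = n then M.totalRate x else 0 := by
  rw [gen_eq, sub_add_cancel]
  refine add_nonneg (add_nonneg (add_nonneg ?_ ?_) ?_) ?_ <;> split_ifs
  exacts [(upK_pos l).le, le_rfl, upJ_nonneg hx l, le_rfl, (downK_pos hx l).le, le_rfl,
    (downJ_pos l).le, le_rfl]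

theorem blockA0_nonneg (hx : M.InStateSpace x) (a b : M.Phase) : 0 ≤ M.blockA0 x a b := by
  have := gen_add_nonneg hx (M.level 0 a) (M.level 1 b)
  rwa [if_neg (level_ne zero_ne_one _ _), add_zero] at this

theorem blockA2_nonneg (hx : M.InStateSpace x) (a b : M.Phase) : 0 ≤ M.blockA2 x a b := by
  have := gen_add_nonneg hx (M.level 1 a) (M.level 0 b)
  rwa [if_neg (level_ne one_ne_zero _ _), add_zero] at this

theorem blockA1_add_nonneg (hx : M.InStateSpace x) (a b : M.Phase) :
    0 ≤ (M.blockA1 x + M.totalRate x • (1 : Matrix M.Phase M.Phase ℝ)) a b := by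
  have h := gen_add_nonneg hx (M.level 1 a) (M.level 1 b)
  have e : M.level 1 a = M.level 1 b ↔ a = b :=
    ⟨fun h => (Prod.ext_iff.1 (M.level_bijective.1 (a₁ := (1, a)) (a₂ := (1, b)) h)).2,
      fun h => h ▸ rfl⟩
  simp only [e] at h
  rw [Matrix.add_apply, Matrix.smul_apply, Matrix.one_apply, smul_eq_mul, mul_ite, mul_one,
    mul_zero]
  exact h

theorem hasSum_gen (l : ℤ) : HasSum (fun n => M.gen x l n) 0 := by
  have h := ((((hasSum_ite_eq (l + M.k) (M.upK l)).add (hasSum_ite_eq (l + M.j) (M.upJ x l))).add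
    (hasSum_ite_eq (l - M.k) (M.downK x l))).add (hasSum_ite_eq (l - M.j) (M.downJ l))).sub
    (hasSum_ite_eq l (M.totalRate x))
  rw [sum_rates, sub_self] at h
  refine h.congr_terms fun n => ?_
  have e1 : (l = n - M.k) ↔ (n = l + M.k) := by omega
  have e2 : (l = n - M.j) ↔ (n = l + M.j) := by omega
  have e3 : (l = n + M.k) ↔ (n = l - M.k) := by omega
  have e4 : (l = n + M.j) ↔ (n = l - M.j) := by omega
  simp only [gen_eq, e1, e2, e3, e4, eq_comm (a := l) (b := n)]

/-- Sums over the state space of functions that live on finitely many levels. -/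
theorem hasSum_levels {f : ℤ → ℝ} {N : ℕ} (h : ∀ n b, N ≤ n → f (M.level n b) = 0) :
    HasSum f (∑ n ∈ Finset.range N, ∑ b, f (M.level n b)) := by
  rw [← M.levelEquiv.hasSum_iff]
  rw [← Finset.sum_product' (s := Finset.range N) (t := Finset.univ)
    (f := fun n b => f (M.level n b))]
  refine hasSum_sum_of_ne_finset_zero (f := f ∘ M.levelEquiv) fun p hp => ?_
  refine h p.1 p.2 ?_
  by_contra! hlt
  exact hp (Finset.mem_product.2 ⟨Finset.mem_range.2 hlt, Finset.mem_univ _⟩)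

theorem genDual_level_zero (α : ℤ → ℝ) (b : M.Phase) :
    M.genDual x α (M.level 0 b)
      = ((fun c => α (M.level 0 c)) ᵥ* M.blockB x
        + (fun c => α (M.level 1 c)) ᵥ* M.blockA2 x) b := by
  refine (hasSum_mul_gen α _).unique ?_
  have h := hasSum_levels (M := M) (N := 2) (f := fun l => α l * M.gen x l (M.level 0 b))
    fun n c hn => by rw [gen_level_far (Or.inr (by omega)), mul_zero]
  rw [Finset.sum_range_succ, Finset.sum_range_one] at h
  exact h

theorem genDual_level_succ (α : ℤ → ℝ) (q : ℕ) (b : M.Phase) :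
    M.genDual x α (M.level (q + 1) b)
      = ((fun c => α (M.level q c)) ᵥ* M.blockA0 x + (fun c => α (M.level (q + 1) c)) ᵥ* M.blockA1 x
        + (fun c => α (M.level (q + 2) c)) ᵥ* M.blockA2 x) b := by
  refine (hasSum_mul_gen α _).unique ?_
  have h := hasSum_levels (M := M) (N := q + 3)
    (f := fun l => α l * M.gen x l (M.level (q + 1) b))
    fun n c hn => by rw [gen_level_far (Or.inr (by omega)), mul_zero]
  rw [Finset.sum_range_succ, Finset.sum_range_succ, Finset.sum_range_succ, Finset.sum_eq_zero,
    zero_add] at h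
  · simp only [gen_level_up, gen_level_same, gen_level_down] at h
    exact h
  · intro n hn
    rw [Finset.mem_range] at hn
    exact Finset.sum_eq_zero fun c _ => by rw [gen_level_far (Or.inl (by omega)), mul_zero]

theorem blockB_add_blockA0_mulVec_one : M.blockB x *ᵥ 1 + M.blockA0 x *ᵥ 1 = 0 := by
  ext a
  have h := hasSum_levels (M := M) (N := 2) (f := fun n => M.gen x (M.level 0 a) n)
    fun n c hn => gen_level_far (Or.inl (by omega)) _ _
  rw [Finset.sum_range_succ, Finset.sum_range_one] at h
  simp only [Pi.add_apply, Matrix.mulVec, dotProduct_one, Pi.zero_apply]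
  exact h.unique (hasSum_gen _)

theorem blockA_sum_mulVec_one :
    M.blockA2 x *ᵥ 1 + M.blockA1 x *ᵥ 1 + M.blockA0 x *ᵥ 1 = 0 := by
  ext a
  have h := hasSum_levels (M := M) (N := 3) (f := fun n => M.gen x (M.level 1 a) n)
    fun n c hn => gen_level_far (Or.inl (by omega)) _ _
  rw [Finset.sum_range_succ, Finset.sum_range_succ, Finset.sum_range_one] at h
  simp only [gen_level_up, Pi.add_apply, Matrix.mulVec, dotProduct_one, Pi.zero_apply] at h ⊢
  exact h.unique (hasSum_gen _)

/-! ### A superinvariant geometric measure -/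

theorem eventually_neg_of_hasDerivAt {f : ℝ → ℝ} {f' : ℝ} (hf : HasDerivAt f f' 1) (hf' : 0 < f')
    (h : f 1 = 0) : ∀ᶠ ζ in 𝓝[<] (1 : ℝ), f ζ < 0 := by
  have := eventually_nhdsWithin_sign_eq_of_deriv_pos (hf.deriv.symm ▸ hf') h
  filter_upwards [nhdsWithin_le_nhds this, self_mem_nhdsWithin] with ζ h1 h2
  rw [sign_neg (sub_neg.2 h2)] at h1
  exact sign_eq_neg_one_iff.1 h1

theorem hasDerivAt_zpow_sum (a b c d T : ℝ) (k j : ℤ) :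
    HasDerivAt (fun ζ : ℝ => a * ζ ^ (-k) + b * ζ ^ (-j) + c * ζ ^ k + d * ζ ^ j - T)
      (j * (d - b) + k * (c - a)) 1 := by
  have h := fun m : ℤ => hasDerivAt_zpow m (1 : ℝ) (Or.inl one_ne_zero)
  simp only [one_zpow, mul_one] at h
  refine ((((((h (-k)).const_mul a).add ((h (-j)).const_mul b)).add ((h k).const_mul c)).add
    ((h j).const_mul d)).sub_const T).congr_deriv ?_
  push_cast; ring

variable (M x) in
/-- The ratio `ζ` is such that the geometric measure `geomMeasure ζ` is strictly superinvariant away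
from the origin. -/
def IsGoodRatio (ζ : ℝ) : Prop :=
  0 < ζ ∧ ζ < 1 ∧
  M.upKPos * ζ ^ (-(M.k : ℤ)) + M.upJPos x * ζ ^ (-(M.j : ℤ)) + M.downKPos x * ζ ^ (M.k : ℤ)
    + M.downJPos * ζ ^ (M.j : ℤ) - M.totalRate x < 0 ∧
  M.downKNeg x * ζ ^ (-(M.k : ℤ)) + M.downJNeg * ζ ^ (-(M.j : ℤ)) + M.upKNeg * ζ ^ (M.k : ℤ)
    + M.upJNeg x * ζ ^ (M.j : ℤ) - M.totalRate x < 0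

/-- Both expressions vanish at `ζ = 1`, as the rates sum to `T`, and their derivatives there are
`-δ₊` and `δ₋`. Both are positive, so both expressions are negative just to the left of `1`. -/
theorem exists_isGoodRatio (hpos : M.driftPos x < 0) (hneg : 0 < M.driftNeg x) :
    ∃ ζ, M.IsGoodRatio x ζ := by
  have r1 := sum_rates (M := M) (x := x) 1
  have r0 := sum_rates (M := M) (x := x) 0
  simp only [upK, upJ, downK, downJ, zero_lt_one, lt_irrefl, if_true, if_false] at r1 r0
  have h1 := eventually_neg_of_hasDerivAt
    (hasDerivAt_zpow_sum M.upKPos (M.upJPos x) (M.downKPos x) M.downJPos (M.totalRate x) M.k M.j)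
    (by unfold driftPos at hpos; push_cast; linarith) (by simp only [one_zpow, mul_one]; linarith)
  have h2 := eventually_neg_of_hasDerivAt
    (hasDerivAt_zpow_sum (M.downKNeg x) M.downJNeg M.upKNeg (M.upJNeg x) (M.totalRate x) M.k M.j)
    (by unfold driftNeg at hneg; push_cast; linarith) (by simp only [one_zpow, mul_one]; linarith)
  have h3 : ∀ᶠ ζ in 𝓝[<] (1 : ℝ), 0 < ζ := nhdsWithin_le_nhds (lt_mem_nhds one_pos)
  obtain ⟨ζ, h⟩ := (h1.and (h2.and (h3.and self_mem_nhdsWithin))).exists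
  exact ⟨ζ, h.2.2.1, h.2.2.2, h.1, h.2.1⟩

/-- The measure on `ℤ` that is geometric in both directions away from the origin. -/
noncomputable def geomMeasure (ζ : ℝ) (z : ℤ) : ℝ := if 0 < z then ζ ^ (z - 1) else ζ ^ (-z)

/-- Beyond `m` all states that enter the balance at `z` are positive, so it equals `ζ ^ (z - 1)`
times the expression in `IsGoodRatio`. -/
theorem genDual_geomMeasure_pos {ζ : ℝ} (h : M.IsGoodRatio x ζ) {z : ℤ} (hz : M.blk < z) :
    M.genDual x (geomMeasure ζ) z ≤ 0 := by
  have hj := j_le_blk (M := M)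
  have hk := k_le_blk (M := M)
  have h0 := h.1.ne'
  have e : ∀ d : ℤ, ζ ^ (z + d - 1) = ζ ^ (z - 1) * ζ ^ d := fun d => by
    rw [← zpow_add₀ h0]; ring_nf
  rw [genDual]
  simp only [geomMeasure, upK, upJ, downK, downJ, sub_eq_add_neg z]
  rw [if_pos (show 0 < z + -(M.k : ℤ) by omega), if_pos (show 0 < z + -(M.j : ℤ) by omega),
    if_pos (show 0 < z + (M.k : ℤ) by omega), if_pos (show 0 < z + (M.j : ℤ) by omega),
    if_pos (show 0 < z by omega)]
  rw [if_pos (show 0 < z + -(M.k : ℤ) by omega), if_pos (show 0 < z + -(M.j : ℤ) by omega),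
    if_pos (show 0 < z + (M.k : ℤ) by omega), if_pos (show 0 < z + (M.j : ℤ) by omega)]
  rw [e, e, e, e, ← sub_eq_add_neg]
  have := mul_nonpos_of_nonneg_of_nonpos (zpow_pos h.1 (z - 1)).le h.2.2.1.le
  linarith

theorem genDual_geomMeasure_neg {ζ : ℝ} (h : M.IsGoodRatio x ζ) {z : ℤ} (hz : z + M.blk ≤ 0) :
    M.genDual x (geomMeasure ζ) z ≤ 0 := by
  have hj := j_le_blk (M := M)
  have hk := k_le_blk (M := M)
  have h0 := h.1.ne'
  have := M.j_pos
  have := M.k_pos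
  have e : ∀ d : ℤ, ζ ^ (-(z + d)) = ζ ^ (-z) * ζ ^ (-d) := fun d => by
    rw [← zpow_add₀ h0]; ring_nf
  rw [genDual]
  simp only [geomMeasure, upK, upJ, downK, downJ, sub_eq_add_neg z]
  rw [if_neg (show ¬ 0 < z + -(M.k : ℤ) by omega), if_neg (show ¬ 0 < z + -(M.j : ℤ) by omega),
    if_neg (show ¬ 0 < z + (M.k : ℤ) by omega), if_neg (show ¬ 0 < z + (M.j : ℤ) by omega),
    if_neg (show ¬ 0 < z by omega)]
  rw [if_neg (show ¬ 0 < z + -(M.k : ℤ) by omega), if_neg (show ¬ 0 < z + -(M.j : ℤ) by omega),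
    if_neg (show ¬ 0 < z + (M.k : ℤ) by omega), if_neg (show ¬ 0 < z + (M.j : ℤ) by omega)]
  rw [e, e, e, e, neg_neg, neg_neg]
  have := mul_nonpos_of_nonneg_of_nonpos (zpow_pos h.1 (-z)).le h.2.2.2.le
  linarith

variable (M) in
/-- The restriction of `geomMeasure` to level `0`. -/
noncomputable def geomPhase (ζ : ℝ) : M.Phase → ℝ :=
  Sum.elim (fun i : Fin M.blk => ζ ^ (i : ℕ)) (fun i : Fin M.blk => ζ ^ (i : ℕ))

theorem geomPhase_pos {ζ : ℝ} (h : 0 < ζ) (b : M.Phase) : 0 < M.geomPhase ζ b := by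
  rcases b with i | i <;> exact pow_pos h _

/-- The exponent is `0` at both states `1` and `0`, where the two halves of the levels start; hence
one ratio `η = ζ^m` serves both sides. -/
theorem geomMeasure_level (ζ : ℝ) (n : ℕ) (b : M.Phase) :
    geomMeasure ζ (M.level n b) = (ζ ^ M.blk) ^ n * M.geomPhase ζ b := by
  rw [← pow_mul, mul_comm M.blk]
  rcases b with i | i
  · rw [geomMeasure, if_pos (level_inl_pos n i), level_inl, add_sub_cancel_right, zpow_natCast,
      pow_add]
    rfl
  · rw [geomMeasure, if_neg (level_inr_nonpos n i).not_gt, level_inr, neg_neg, zpow_natCast,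
      pow_add]
    rfl

/-- This is the balance on level `1`, whose states are `> m` or `≤ -m`, just far enough from the
origin. -/
theorem geomPhase_superinvariant {ζ : ℝ} (h : M.IsGoodRatio x ζ) (b : M.Phase) :
    (M.geomPhase ζ ᵥ* M.blockA0 x + (ζ ^ M.blk • M.geomPhase ζ) ᵥ* M.blockA1 x
      + ((ζ ^ M.blk) ^ 2 • M.geomPhase ζ) ᵥ* M.blockA2 x) b ≤ 0 := by
  have e := genDual_level_succ (x := x) (geomMeasure ζ) 0 b
  simp only [geomMeasure_level, zero_add, pow_zero, one_mul, pow_one] at e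
  refine le_trans (le_of_eq e.symm) ?_
  rcases b with i | i
  · refine genDual_geomMeasure_pos h ?_
    rw [level_inl]; omega
  · refine genDual_geomMeasure_neg h ?_
    rw [level_inr]; omega

/-! ### Matrix-geometric invariant measures. -/

variable (M) in
/-- The measure that equals `a Rⁿ` on level `n`. -/
noncomputable def geomExtension (R : Matrix M.Phase M.Phase ℝ) (a : M.Phase → ℝ) (z : ℤ) : ℝ :=
  (a ᵥ* R ^ (M.levelEquiv.symm z).1) (M.levelEquiv.symm z).2

theorem geomExtension_level (R : Matrix M.Phase M.Phase ℝ) (a : M.Phase → ℝ) (n : ℕ)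
    (b : M.Phase) : M.geomExtension R a (M.level n b) = (a ᵥ* R ^ n) b := by
  rw [geomExtension, levelEquiv_symm_level]

/-- Balance on level `0` is the boundary equation; on level `q + 1` it is `a R^q` times the equation
for `R`. -/
theorem genDual_geomExtension {R : Matrix M.Phase M.Phase ℝ} {a : M.Phase → ℝ}
    (hR : M.blockA0 x + R * M.blockA1 x + R ^ 2 * M.blockA2 x = 0)
    (ha : a ᵥ* (M.blockB x + R * M.blockA2 x) = 0) (z : ℤ) :
    M.genDual x (M.geomExtension R a) z = 0 := by
  obtain ⟨⟨n, b⟩, rfl⟩ := M.level_bijective.2 z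
  dsimp only
  rcases n with - | q
  · rw [genDual_level_zero]
    simp only [geomExtension_level, pow_zero, pow_one, Matrix.vecMul_one]
    rw [Matrix.vecMul_vecMul, ← Matrix.vecMul_add, ha, Pi.zero_apply]
  · rw [genDual_level_succ]
    simp only [geomExtension_level]
    change ((a ᵥ* R ^ q) ᵥ* M.blockA0 x + (a ᵥ* R ^ (q + 1)) ᵥ* M.blockA1 x
      + (a ᵥ* R ^ (q + 2)) ᵥ* M.blockA2 x) b = 0
    rw [pow_succ, pow_add, ← Matrix.vecMul_vecMul a, ← Matrix.vecMul_vecMul a,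
      Matrix.vecMul_vecMul _ R, Matrix.vecMul_vecMul _ (R ^ 2), ← Matrix.vecMul_add,
      ← Matrix.vecMul_add, hR, Matrix.vecMul_zero, Pi.zero_apply]

/-- The matrix `B + R A₂` has zero row sums. -/
theorem blockB_add_mulVec_one {R : Matrix M.Phase M.Phase ℝ}
    (hR : M.blockA0 x + R * M.blockA1 x + R ^ 2 * M.blockA2 x = 0) (hu : IsUnit (1 - R)) :
    (M.blockB x + R * M.blockA2 x) *ᵥ 1 = 0 := by
  have h1 := blockB_add_blockA0_mulVec_one (M := M) (x := x)
  have h2 := blockA_sum_mulVec_one (M := M) (x := x)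
  set u := M.blockA0 x *ᵥ 1
  set v := M.blockA1 x *ᵥ 1
  set w := M.blockA2 x *ᵥ 1 with hw
  have h3 : u + R *ᵥ v + R *ᵥ (R *ᵥ w) = 0 := by
    have := congrArg (· *ᵥ (1 : M.Phase → ℝ)) hR
    simp only [Matrix.add_mulVec, Matrix.zero_mulVec, sq, ← Matrix.mulVec_mulVec] at this
    exact this
  have hv : v = -u - w := by
    rw [eq_sub_iff_add_eq, eq_neg_iff_add_eq_zero, ← h2]; abel
  -- With `v = -u - w` the equation for `R` applied to `1` factors in this way. Cancelling `1 - R`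
  -- gives `A₀ 1 = R A₂ 1`, which is the claim because `B 1 = -A₀ 1`.
  have h4 : (1 - R) *ᵥ (u - R *ᵥ w) = 0 := by
    rw [← h3, hv]
    simp only [Matrix.sub_mulVec, Matrix.one_mulVec, Matrix.mulVec_sub, Matrix.mulVec_neg]
    abel
  have h5 : u - R *ᵥ w = 0 :=
    Matrix.mulVec_injective_iff_isUnit.2 hu (h4.trans (Matrix.mulVec_zero _).symm)
  rw [Matrix.add_mulVec, ← Matrix.mulVec_mulVec, ← hw, eq_neg_of_add_eq_zero_left h1,
    ← sub_eq_zero.1 h5, neg_add_cancel]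

theorem hasSum_of_level {ι : Type*} {f : ℤ → ℝ} {s : ℝ} {c : ι → M.Phase}
    (hc : Function.Injective c) (hf : ∀ n b, b ∉ Set.range c → f (M.level n b) = 0)
    (h : HasSum (fun p : ℕ × ι => f (M.level p.1 (c p.2))) s) : HasSum f s := by
  rw [← M.levelEquiv.hasSum_iff]
  have hinj : Function.Injective (Prod.map id c : ℕ × ι → ℕ × M.Phase) :=
    Function.injective_id.prodMap hc
  refine (hinj.hasSum_iff fun p hp => hf p.1 p.2 ?_).1 h
  rintro ⟨i, hi⟩
  exact hp ⟨(p.1, i), Prod.ext rfl hi⟩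

end XModel

/-! ### Assembly of the theorem. -/

theorem theorem6p2 (M : XModel) (x : FluidState) (hx : M.OnBoundary x)
    (hpos : M.driftPos x < 0) (hneg : 0 < M.driftNeg x) :
    (M.r = 1 → XModel.IsPi.{u} M x (M.driftNeg x / (M.driftNeg x - M.driftPos x))) ∧
    ∃ (R : Matrix M.Phase M.Phase ℝ) (Rpos Rneg : Matrix (Fin M.blk) (Fin M.blk) ℝ),
      M.IsRateMatrix x R ∧ R = Matrix.fromBlocks Rpos 0 0 Rneg ∧
      IsUnit (1 - Rpos) ∧ IsUnit (1 - Rneg) ∧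
      (∃! a, M.IsBoundaryVector x R a) ∧
      ∀ a, M.IsBoundaryVector x R a →
        (∃ α, M.IsStationary x α ∧ ∃ c > 0, ∀ b, a b = c * α (M.level 0 b)) ∧
        0 < blockMass (a ∘ Sum.inl) Rpos + blockMass (a ∘ Sum.inr) Rneg ∧
        XModel.IsPi.{u} M x
          (blockMass (a ∘ Sum.inl) Rpos /
            (blockMass (a ∘ Sum.inl) Rpos + blockMass (a ∘ Sum.inr) Rneg)) := by
  replace hx := hx.1
  obtain ⟨ζ, hζ⟩ := XModel.exists_isGoodRatio hpos hneg
  have hβ := XModel.geomPhase_pos (M := M) hζ.1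
  have hη : 0 ≤ ζ ^ M.blk := pow_nonneg hζ.1.le _
  have hη1 : ζ ^ M.blk < 1 := pow_lt_one₀ hζ.1.le hζ.2.1 XModel.blk_pos.ne'
  obtain ⟨R, hR0, hReq, hRmin, hRβ, hRσ⟩ := Matrix.exists_least_solution (XModel.totalRate_pos hx)
    (XModel.blockA0_nonneg hx) (XModel.blockA1_add_nonneg hx) (XModel.blockA2_nonneg hx) hη hβ
    (XModel.geomPhase_superinvariant hζ)
  have hRblock : R = Matrix.fromBlocks R.toBlocks₁₁ 0 0 R.toBlocks₂₂ := by
    have hcross := hRσ (fun b => b.isLeft = true) fun a b h => XModel.block_cross h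
    ext (i | i) (i' | i')
    · rfl
    · exact hcross _ _ (by simp)
    · exact hcross _ _ (by simp)
    · rfl
  set Rp := R.toBlocks₁₁
  set Rn := R.toBlocks₂₂
  have hvec : ∀ (v : M.Phase → ℝ) (n : ℕ), v ᵥ* R ^ n
      = Sum.elim ((v ∘ Sum.inl) ᵥ* Rp ^ n) ((v ∘ Sum.inr) ᵥ* Rn ^ n) := by
    intro v n
    rw [hRblock, Matrix.fromBlocks_diagonal_pow, Matrix.vecMul_fromBlocks]
    simp
  have hRpβ : ∀ b, ((M.geomPhase ζ ∘ Sum.inl) ᵥ* Rp) b ≤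
      ζ ^ M.blk * (M.geomPhase ζ ∘ Sum.inl) b := by
    intro b
    have h := hRβ (Sum.inl b)
    rw [← pow_one R, hvec] at h
    simpa using h
  have hRnβ : ∀ b, ((M.geomPhase ζ ∘ Sum.inr) ᵥ* Rn) b ≤
      ζ ^ M.blk * (M.geomPhase ζ ∘ Sum.inr) b := by
    intro b
    have h := hRβ (Sum.inr b)
    rw [← pow_one R, hvec] at h
    simpa using h
  have hRp0 : ∀ a b, 0 ≤ Rp a b := fun a b => hR0 _ _
  have hRn0 : ∀ a b, 0 ≤ Rn a b := fun a b => hR0 _ _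
  have hu := Matrix.isUnit_one_sub hR0 hβ hη hη1 hRβ
  have hsummable : ∀ a, Summable (M.geomExtension R a) := fun a => by
    rw [← M.levelEquiv.summable_iff]
    refine (Matrix.summable_vecMul_pow hR0 hβ hη hη1 hRβ a).congr fun p => ?_
    exact (XModel.geomExtension_level R a p.1 p.2).symm
  have hlevel0 : ∀ a b, M.geomExtension R a (M.level 0 b) = a b := fun a b => by
    rw [XModel.geomExtension_level, pow_zero, Matrix.vecMul_one]
  -- The sign dichotomy of the invariant extension, read on level `0`: the total mass is a faithful
  -- functional on the left kernel of `B + R A₂`. Existence and uniqueness both follow from it.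
  have hsign : ∀ a, a ᵥ* (M.blockB x + R * M.blockA2 x) = 0 →
      (∀ b, a b = 0) ∨ (0 < a ⬝ᵥ 1 ∧ ∀ z, 0 < M.geomExtension R a z) ∨ a ⬝ᵥ 1 < 0 := by
    intro a ha
    have hne : (Finset.univ : Finset M.Phase).Nonempty :=
      ⟨Sum.inl ⟨0, XModel.blk_pos⟩, Finset.mem_univ _⟩
    rw [dotProduct_one]
    rcases XModel.sign_of_invariant hx (hsummable a) (XModel.genDual_geomExtension hReq ha)
      with h | h | h
    · exact Or.inl fun b => hlevel0 a b ▸ h _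
    · exact Or.inr (Or.inl ⟨Finset.sum_pos (fun b _ => hlevel0 a b ▸ h _) hne, h⟩)
    · exact Or.inr (Or.inr (Finset.sum_neg (fun b _ => hlevel0 a b ▸ h _) hne))
  have hexists : ∃ a, M.IsBoundaryVector x R a := by
    -- The vector `1` lies in the right kernel, so the determinant vanishes and the left kernel is
    -- nonzero.
    obtain ⟨v, hv0, hv⟩ := Matrix.exists_vecMul_eq_zero_iff.2
      (Matrix.exists_mulVec_eq_zero_iff.1 ⟨1, fun h =>
        one_ne_zero (α := ℝ) (congrFun h (Sum.inl ⟨0, XModel.blk_pos⟩)),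
        XModel.blockB_add_mulVec_one hReq hu⟩)
    have hne : v ⬝ᵥ 1 ≠ 0 := by
      rcases hsign v hv with h | h | h
      · exact absurd (funext h) hv0
      · exact h.1.ne'
      · exact h.ne
    refine ⟨(v ⬝ᵥ 1)⁻¹ • v, ?_, ?_⟩
    · rw [Matrix.smul_vecMul, hv, smul_zero]
    · rw [smul_dotProduct, smul_eq_mul, inv_mul_cancel₀ hne]
  have hunique : ∀ a a', M.IsBoundaryVector x R a → M.IsBoundaryVector x R a' → a = a' := by
    intro a a' ha ha'
    have h1 : (a - a') ⬝ᵥ 1 = 0 := by rw [sub_dotProduct, ha.2, ha'.2, sub_self]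
    rcases hsign (a - a') (by rw [Matrix.sub_vecMul, ha.1, ha'.1, sub_self]) with h | h | h
    · exact sub_eq_zero.1 (funext h)
    · exact absurd h1 h.1.ne'
    · exact absurd h1 h.ne
  have hmain : ∀ a, M.IsBoundaryVector x R a →
      0 < blockMass (a ∘ Sum.inl) Rp + blockMass (a ∘ Sum.inr) Rn ∧
      ∃ α, M.IsStationary x α ∧
      (∀ b, a b = (blockMass (a ∘ Sum.inl) Rp + blockMass (a ∘ Sum.inr) Rn) * α (M.level 0 b)) ∧
      ∑' n, (Set.Ioi 0).indicator α n = blockMass (a ∘ Sum.inl) Rp /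
            (blockMass (a ∘ Sum.inl) Rp + blockMass (a ∘ Sum.inr) Rn) := by
    intro a ha
    have hpos' : ∀ z, 0 < M.geomExtension R a z := by
      rcases hsign a ha.1 with h | h | h
      · have h1 := ha.2
        rw [show a = 0 from funext h, zero_dotProduct] at h1
        exact absurd h1 zero_ne_one
      · exact h.2
      · exact absurd ha.2 (h.trans one_pos).ne
    set bp := blockMass (a ∘ Sum.inl) Rp
    set bn := blockMass (a ∘ Sum.inr) Rn
    set γ := M.geomExtension R a with hγ
    -- The positive states are the left phases of all levels, where `a Rⁿ` reduces to the powers of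
    -- the block `Rp`.
    have hp : HasSum ((Set.Ioi 0).indicator γ) bp := by
      refine XModel.hasSum_of_level (M := M) (c := Sum.inl) Sum.inl_injective (fun n b hb => ?_) ?_
      · rcases b with i | i
        · exact absurd ⟨i, rfl⟩ hb
        · exact Set.indicator_of_notMem (XModel.level_inr_nonpos n i).not_gt _
      · refine (Matrix.hasSum_blockMass hRp0 (fun b => hβ _) hη hη1 hRpβ _).congr_terms fun p => ?_
        rw [Set.indicator_of_mem (s := Set.Ioi (0 : ℤ)) (XModel.level_inl_pos p.1 p.2), hγ,
          XModel.geomExtension_level, hvec]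
        rfl
    have hn : HasSum ((Set.Ioi 0)ᶜ.indicator γ) bn := by
      refine XModel.hasSum_of_level (M := M) (c := Sum.inr) Sum.inr_injective (fun n b hb => ?_) ?_
      · rcases b with i | i
        · exact Set.indicator_of_notMem (s := (Set.Ioi (0 : ℤ))ᶜ)
            (fun h => h (XModel.level_inl_pos n i)) _
        · exact absurd ⟨i, rfl⟩ hb
      · refine (Matrix.hasSum_blockMass hRn0 (fun b => hβ _) hη hη1 hRnβ _).congr_terms fun p => ?_
        rw [Set.indicator_of_mem (s := (Set.Ioi (0 : ℤ))ᶜ) (XModel.level_inr_nonpos p.1 p.2).not_gt,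
          hγ,
          XModel.geomExtension_level, hvec]
        rfl
    have htot : HasSum γ (bp + bn) := by
      refine (hp.add hn).congr_terms fun z => ?_
      exact (congrFun (Set.indicator_self_add_compl (Set.Ioi 0) γ) z).symm
    have hc : 0 < bp + bn := by
      rw [← htot.tsum_eq]
      exact htot.summable.tsum_pos (fun z => (hpos' z).le) 0 (hpos' 0)
    refine ⟨hc, fun z => γ z / (bp + bn), ⟨fun z => (div_pos (hpos' z) hc).le, ?_, fun n => ?_⟩,
      fun b => ?_, ?_⟩
    · have := htot.div_const (bp + bn)
      rwa [div_self hc.ne'] at this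
    · have h1 := (XModel.hasSum_mul_gen (M := M) (x := x) γ n).div_const (bp + bn)
      rw [XModel.genDual_geomExtension hReq ha.1, zero_div] at h1
      exact h1.congr_terms fun l => by ring
    · rw [hγ]
      dsimp only
      rw [hlevel0, mul_div_cancel₀ _ hc.ne']
    · refine HasSum.tsum_eq ((hp.div_const (bp + bn)).congr_terms fun z => ?_)
      simp only [Set.indicator_apply]
      split_ifs
      exacts [rfl, (zero_div _).symm]
  obtain ⟨a, ha⟩ := hexists
  refine ⟨fun _ => ?_, R, Rp, Rn, ⟨⟨hR0, hReq⟩, fun R' hR' => hRmin R' hR'.1 hR'.2⟩, hRblock,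
    Matrix.isUnit_one_sub hRp0 (fun b => hβ _) hη hη1 hRpβ,
    Matrix.isUnit_one_sub hRn0 (fun b => hβ _) hη hη1 hRnβ,
    ⟨a, ha, fun a' ha' => hunique a' a ha' ha⟩, fun a ha => ?_⟩
  · obtain ⟨-, α, hα, -, -⟩ := hmain a ha
    exact hα.tsum_indicator_eq hx hpos hneg ▸ hα.isPi hx
  · obtain ⟨hc, α, hα, hb, hs⟩ := hmain a ha
    exact ⟨⟨α, hα, _, hc, hb⟩, hc, hs ▸ hα.isPi hx⟩
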